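/- Let $\mathfrak X$ be a compact metric space. For Borel probability measures $\mu,\nu$ on $\mathfrak X$ let $\mathrm W(\mu,\nu)=\sup\{E_\mu D-E_\nu D : D:\mathfrak X\to\mathbb R \text{ 1-Lipschitz}\}$ be the Wasserstein distance. Let $\mathcal H_k$ be a universal reproducing kernel Hilbert space on $\mathfrak X$ with continuous kernel $k$ such that $|k(x,y)|<K$ for all $x,y\in\mathfrak X$, let $\mathrm{MMD}(\mu,\nu)=\sup\{E_\mu h-E_\nu h : h\in\mathcal H_k,\ \|h\|\le 1\}$, and put $\mathrm{WMMD}=\mathrm W+\mathrm{MMD}$. **Data.** Let $F=(1-\varepsilon)F_0+\varepsilon Q$ with probability measures $F_0,Q$ on $\mathfrak X$ and $\varepsilon\in(0,\tfrac12)$, and let $\mathrm W(F_0,Q)=c$ (finite, as $\mathfrak X$ is compact). Let $\zeta_1,\zeta_2,\dots$ be i.i.d. Bernoulli$(\varepsilon)$, and let $X_1,X_2,\dots$ be observations such that the pairs $(\zeta_i,X_i)$ are i.i.d. and $X_i\sim F_0$ given $\zeta_i=0$, $X_i\sim Q$ given $\zeta_i=1$. **Posterior approximation.** Fix $a>0$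 and a probability measure $H$ on $\mathfrak X$ (Dirichlet process prior $DP(a,H)$). With $F_{X_{1:n}}=\frac1n\sum_{i\le n}\delta_{X_i}$, put $H^*=\frac{a}{a+n}H+\frac{n}{a+n}F_{X_{1:n}}$ (the base measure of the posterior $DP(a+n,H^*)$) and $$F^{\mathrm{pos}}_N=\sum_{i=1}^N J_i\,\delta_{X_i^{\mathrm{pos}}},$$ where, given the data, $X^{\mathrm{pos}}_1,\dots,X^{\mathrm{pos}}_N$ are i.i.d. $\sim H^*$, and $(J_1,\dots,J_N)\sim\mathrm{Dir}(\frac{a+n}N,\dots,\frac{a+n}N)$ is independent of the data and of the $X_i^{\mathrm{pos}}$. **Generator.** Let $\boldsymbol\Omega\subset\mathbb R^{t}$ be compact, let $(\omega,z)\mapsto Gen_\omega(z)$ be continuous from $\boldsymbol\Omega\times\mathbb R^p$ to $\mathfrak X$, let $F_Z$ be a probability measure on $\mathbb R^p$ (for instance standard Gaussian), and let $F_{Gen_\omega}$ be the law of $Gen_\omega(Z)$ for $Z\sim F_Z$. Let $Z_1,\dots,Z_N$ be i.i.d. $\sim F_Z$, independent of all the other variables. Assume the well-specified case: $\mathrm{WMMD}(F,F_{Gen_{\omega_{\mathrm{True}}}})=0$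 for some $\omega_{\mathrm{True}}\in\boldsymbol\Omega$. Let $\omega^*_{BNPL}=\omega^*_{BNPL}(n,N)$ be a measurable choice of a random parameter in $\boldsymbol\Omega$ such that either, for all $n,N\ge1$, it almost surely minimizes $\omega\mapsto\mathrm{WMMD}(F^{\mathrm{pos}}_N,F_{Gen_\omega})$ over $\boldsymbol\Omega$, or, for all $n,N\ge1$, it almost surely minimizes $\omega\mapsto\mathrm{WMMD}(F^{\mathrm{pos}}_N,\frac1N\sum_{i\le N}\delta_{Gen_\omega(Z_i)})$ over $\boldsymbol\Omega$. Then $\mathrm{WMMD}(F_0,F_{Gen_{\omega^*_{BNPL}}})$ is integrable for all $n,N$, and $$\limsup_{n,N\to\infty}E\big[\mathrm{WMMD}(F_0,F_{Gen_{\omega^*_{BNPL}}})\big]\le(2\sqrt K+c)\,\varepsilon .$$ In particular, if the kernel is normalized so that $K\le1$, then $$\limsup_{n,N\to\infty}E\big[\mathrm{WMMD}(F_0,F_{Gen_{\omega^*_{BNPL}}})\big]\le(2+c)\,\varepsilon .$$ The limit is the joint one: $n$ and $N$ tend to infinity independently of each other. -/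

import Mathlib

open MeasureTheory ProbabilityTheory Filter Topology
open scoped ENNReal

noncomputable section

namespace BNPL

/-! ### Distances between probability measures -/

/-- The Wasserstein distance in its Kantorovich-Rubinstein form: the supremum of
`E_μ[D] - E_ν[D]` over all 1-Lipschitz functions `D`. -/
def wasserstein {𝔛 : Type*} [MetricSpace 𝔛] [MeasurableSpace 𝔛] (μ ν : Measure 𝔛) : ℝ :=
  ⨆ D : {D : 𝔛 → ℝ // LipschitzWith 1 D}, (∫ x, D.1 x ∂μ - ∫ x, D.1 x ∂ν)

/-- The real-valued kernel of a reproducing kernel Hilbert space `𝓗` of real functions on `𝔛`,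
so that `h y = ⟪h, k(·, y)⟫` for all `h ∈ 𝓗`. -/
def kernelFn {𝔛 : Type*} (𝓗 : Type*) [NormedAddCommGroup 𝓗] [InnerProductSpace ℝ 𝓗]
    [CompleteSpace 𝓗] [RKHS ℝ 𝓗 𝔛 ℝ] (x y : 𝔛) : ℝ :=
  RKHS.kernel 𝓗 x y 1

/-- The reproducing kernel Hilbert space is universal: every continuous function is a uniform
limit of elements of `𝓗`. -/
def IsUniversal {𝔛 : Type*} [TopologicalSpace 𝔛] (𝓗 : Type*) [NormedAddCommGroup 𝓗]
    [InnerProductSpace ℝ 𝓗] [RKHS ℝ 𝓗 𝔛 ℝ] : Prop :=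
  ∀ g : C(𝔛, ℝ), ∀ δ > 0, ∃ h : 𝓗, ∀ x, |h x - g x| < δ

/-- The maximum mean discrepancy: the supremum of `E_μ[h] - E_ν[h]` over the unit ball of the
reproducing kernel Hilbert space `𝓗`. -/
def mmd {𝔛 : Type*} [MeasurableSpace 𝔛] (𝓗 : Type*) [NormedAddCommGroup 𝓗]
    [InnerProductSpace ℝ 𝓗] [RKHS ℝ 𝓗 𝔛 ℝ] (μ ν : Measure 𝔛) : ℝ :=
  ⨆ h : {h : 𝓗 // ‖h‖ ≤ 1}, (∫ x, h.1 x ∂μ - ∫ x, h.1 x ∂ν)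

/-- `WMMD = W + MMD`. -/
def wmmd {𝔛 : Type*} [MetricSpace 𝔛] [MeasurableSpace 𝔛] (𝓗 : Type*) [NormedAddCommGroup 𝓗]
    [InnerProductSpace ℝ 𝓗] [RKHS ℝ 𝓗 𝔛 ℝ] (μ ν : Measure 𝔛) : ℝ :=
  wasserstein μ ν + mmd 𝓗 μ ν

/-! ### Huber contamination -/

/-- The contaminated distribution `(1 - ε) F₀ + ε Q`. -/
def huberMixture {𝔛 : Type*} [MeasurableSpace 𝔛] (ε : ℝ) (F₀ Q : Measure 𝔛) : Measure 𝔛 :=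
  ENNReal.ofReal (1 - ε) • F₀ + ENNReal.ofReal ε • Q

/-- The joint law of one pair `(ζ, X)`: the outlier indicator `ζ` is Bernoulli(`ε`)
(`true` has probability `ε`), and given `ζ` the observation `X` has law `F₀` if `ζ = false` and
law `Q` if `ζ = true`. -/
def huberPair {𝔛 : Type*} [MeasurableSpace 𝔛] (ε : ℝ) (F₀ Q : Measure 𝔛) :
    Measure (Bool × 𝔛) :=
  ENNReal.ofReal (1 - ε) • (Measure.dirac false).prod F₀ +
    ENNReal.ofReal ε • (Measure.dirac true).prod Q

/-! ### The Dirichlet process posterior and its finite approximation -/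

/-- The empirical measure `m⁻¹ ∑ δ_{x_i}`. -/
def empirical {𝔛 : Type*} [MeasurableSpace 𝔛] {m : ℕ} (x : Fin m → 𝔛) : Measure 𝔛 :=
  ENNReal.ofReal (1 / (m : ℝ)) • ∑ i, Measure.dirac (x i)

/-- The base measure `H* = a / (a + n) H + n / (a + n) F_{x_{1:n}}` of the posterior
`DP(a + n, H*)` of a Dirichlet process prior `DP(a, H)`, given the data `x_{1:n}`. -/
def posteriorBase {𝔛 : Type*} [MeasurableSpace 𝔛] (a : ℝ) (H : Measure 𝔛) {n : ℕ}
    (x : Fin n → 𝔛) : Measure 𝔛 :=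
  ENNReal.ofReal (a / (a + n)) • H + ENNReal.ofReal (n / (a + n)) • empirical x

/-- The Dirichlet distribution `Dir(α_1, …, α_N)`: the law of the vector
`(Γ_i / (Γ_1 + … + Γ_N))_i` for independent `Γ_i ∼ Gamma(α_i, 1)`. -/
def dirichletMeasure {N : ℕ} (α : Fin N → ℝ) : Measure (Fin N → ℝ) :=
  (Measure.pi fun i => gammaMeasure (α i) 1).map fun g i => g i / ∑ j, g j

/-- The random measure `∑ J_i δ_{y_i}` with weights `J` and atoms `y`. -/
def weightedAtoms {𝔛 : Type*} [MeasurableSpace 𝔛] {N : ℕ} (J : Fin N → ℝ) (y : Fin N → 𝔛) :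
    Measure 𝔛 :=
  ∑ i, ENNReal.ofReal (J i) • Measure.dirac (y i)

instance {𝔛 : Type*} [MeasurableSpace 𝔛] (a : ℝ) (H : Measure 𝔛) [IsFiniteMeasure H] {n : ℕ}
    (x : Fin n → 𝔛) : IsFiniteMeasure (posteriorBase a H x) := by
  unfold posteriorBase empirical
  refine ⟨?_⟩
  simp only [Measure.coe_add, Measure.coe_smul, Pi.add_apply, Pi.smul_apply, smul_eq_mul,
    Measure.coe_finsetSum, Finset.sum_apply, measure_univ, Finset.sum_const,
    Finset.card_univ, Fintype.card_fin, nsmul_eq_mul, mul_one]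
  refine ENNReal.add_lt_top.2 ⟨?_, ?_⟩
  · exact ENNReal.mul_lt_top ENNReal.ofReal_lt_top (measure_lt_top _ _)
  · exact ENNReal.mul_lt_top ENNReal.ofReal_lt_top
      (ENNReal.mul_lt_top ENNReal.ofReal_lt_top (ENNReal.natCast_lt_top n))

theorem measurable_posteriorBase {𝔛 : Type*} [MeasurableSpace 𝔛] (a : ℝ) (H : Measure 𝔛)
    (n : ℕ) {s : Set 𝔛} (hs : MeasurableSet s) :
    Measurable fun d : Fin n → Bool × 𝔛 => posteriorBase a H (fun i => (d i).2) s := by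
  unfold posteriorBase empirical
  simp only [Measure.coe_add, Measure.coe_smul, Pi.add_apply, Pi.smul_apply, smul_eq_mul,
    Measure.coe_finsetSum, Finset.sum_apply]
  refine measurable_const.add (Measurable.const_mul (Measurable.const_mul ?_ _) _)
  refine Finset.measurable_fun_sum _ fun i _ => ?_
  exact (Measure.measurable_coe hs).comp
    (Measure.measurable_dirac.comp (measurable_snd.comp (measurable_pi_apply i)))

/-- The conditional law of the posterior atoms `X^pos_1, …, X^pos_N` given the data: independent
with common law `H*` (which does not depend on the outlier indicators, these being unobserved). -/
def atomKernel {𝔛 : Type*} [MeasurableSpace 𝔛] (a : ℝ) (H : Measure 𝔛) [IsFiniteMeasure H]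
    (n N : ℕ) : Kernel (Fin n → Bool × 𝔛) (Fin N → 𝔛) where
  toFun d := Measure.pi fun _ => posteriorBase a H (fun i => (d i).2)
  measurable' := by
    refine Measurable.measure_of_isPiSystem generateFrom_pi.symm isPiSystem_pi ?_ ?_
    · rintro _ ⟨t, ht, rfl⟩
      simp only [Measure.pi_pi]
      exact Finset.measurable_fun_prod _ fun i _ =>
        measurable_posteriorBase a H n (ht i (Set.mem_univ i))
    · simp only [Measure.pi_univ]
      exact Finset.measurable_fun_prod _ fun i _ => measurable_posteriorBase a H n .univ

/-- The joint law of everything that is drawn with `n` observations and truncation level `N`: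
* the pairs `(ζ_i, X_i)`, `i < n`, independent with law `huberPair ε F₀ Q`;
* given these, the atoms `X^pos_1, …, X^pos_N`, independent with law `H*`;
* independently of these, the weights `J ∼ Dir((a + n) / N, …, (a + n) / N)`;
* independently of all of these, latent variables `Z_1, …, Z_N`, independent with law `FZ`. -/
def sampleLaw {𝔛 𝓩 : Type*} [MeasurableSpace 𝔛] [MeasurableSpace 𝓩] (ε : ℝ) (F₀ Q : Measure 𝔛)
    (a : ℝ) (H : Measure 𝔛) [IsFiniteMeasure H] (FZ : Measure 𝓩) (n N : ℕ) :
    Measure (((Fin n → Bool × 𝔛) × (Fin N → 𝔛)) × (Fin N → ℝ) × (Fin N → 𝓩)) :=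
  ((Measure.pi fun _ : Fin n => huberPair ε F₀ Q) ⊗ₘ atomKernel a H n N).prod
    ((dirichletMeasure fun _ : Fin N => (a + n) / N).prod (Measure.pi fun _ : Fin N => FZ))

/-! ### The generator and its optimized parameter -/

/-- The distribution `F_{Gen_ω}` of `Gen_ω(Z)` for `Z ∼ FZ`. -/
def genLaw {𝔛 𝓩 Par : Type*} [MeasurableSpace 𝔛] [MeasurableSpace 𝓩] (Gen : Par → 𝓩 → 𝔛)
    (FZ : Measure 𝓩) (ω : Par) : Measure 𝔛 :=
  FZ.map (Gen ω)

/-- `ω` minimizes `WMMD(μ, F_{Gen_ω})` over the parameter space. -/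
def IsMinimizer {𝔛 𝓩 Par : Type*} [MetricSpace 𝔛] [MeasurableSpace 𝔛] [MeasurableSpace 𝓩]
    (𝓗 : Type*) [NormedAddCommGroup 𝓗] [InnerProductSpace ℝ 𝓗] [RKHS ℝ 𝓗 𝔛 ℝ]
    (Gen : Par → 𝓩 → 𝔛) (FZ : Measure 𝓩) (μ : Measure 𝔛) (ω : Par) : Prop :=
  ∀ ω' : Par, wmmd 𝓗 μ (genLaw Gen FZ ω) ≤ wmmd 𝓗 μ (genLaw Gen FZ ω')

/-- `ω` minimizes `WMMD(μ, F_{Gen_ω(z_{1:N})})` over the parameter space, where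
`F_{Gen_ω(z_{1:N})}` is the empirical distribution of `Gen_ω(z_1), …, Gen_ω(z_N)`. -/
def IsSampleMinimizer {𝔛 𝓩 Par : Type*} [MetricSpace 𝔛] [MeasurableSpace 𝔛]
    (𝓗 : Type*) [NormedAddCommGroup 𝓗] [InnerProductSpace ℝ 𝓗] [RKHS ℝ 𝓗 𝔛 ℝ]
    (Gen : Par → 𝓩 → 𝔛) {N : ℕ} (z : Fin N → 𝓩) (μ : Measure 𝔛) (ω : Par) : Prop :=
  ∀ ω' : Par, wmmd 𝓗 μ (empirical fun i => Gen ω (z i)) ≤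
    wmmd 𝓗 μ (empirical fun i => Gen ω' (z i))

end BNPL

end

/-! Write `F` for the contaminated law, `ν` for the approximate posterior and `ω*` for the fitted
parameter. The triangle inequality and minimality give WMMD(F₀, Gen_ω*) ≤ WMMD(F₀, F) + 2A₁ + 2A₂.
Here A₁ bounds the distance between `F` and `ν`, and A₂ bounds, uniformly in ω, the distance between
the generator and its simulated version (`wmmd_genLaw_le_of_isMinimizer`). Since F₀ - F = ε(F₀ - Q),
the first term is at most (c + 2√K)ε (`wmmd_huberMixture_le`). It remains to make the expectations
of A₁ and A₂ vanish.

For A₁, Arzelà–Ascoli makes the Lipschitz class (modulo constants) and the unit ball of the RKHS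
totally bounded, so WMMD is controlled, up to δ, by finitely many continuous test functions. AM-GM
turns their absolute errors into squared errors, and second moments are explicit: the atoms
fluctuate around `H*` with variance of order ∑ Jᵢ², whose mean is O(1/N + 1/n); `H*` differs from
the empirical measure by a mass a/(a+n); the empirical measure has variance O(1/n)
(`lintegral_sq_sampleLaw_le`).

For A₂ the bound must be uniform in ω, because ω* may depend on the latent sample. Compactness of
the parameter space and tightness of the latent law again reduce it to finitely many test functions
(`exists_finset_abs_integral_sub_le`).

Altogether the risk is at most (2√K + c)ε + δ + R(1/n + 1/N), with R depending on δ but not on n and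
N. This yields the joint limit, and uses only the joint law of the variables at each fixed (n, N).
-/

namespace BNPL

/-! ### Integral probability metrics -/

/-- A pointwise bounded class of functions with a common continuous modulus on a compact space has
finite uniform nets. -/
theorem exists_finset_net {X : Type*} [TopologicalSpace X] [CompactSpace X] {ρ : X → X → ℝ}
    (hρ : Continuous (Function.uncurry ρ)) (hρ0 : ∀ x, ρ x x = 0) (B : ℝ) {δ : ℝ} (hδ : 0 < δ) :
    ∃ G : Finset C(X, ℝ), ∀ f : X → ℝ, (∀ x, |f x| ≤ B) → (∀ x y, |f x - f y| ≤ ρ x y) →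
      ∃ g ∈ G, ∀ x, |f x - g x| ≤ δ := by
  classical
  set A : Set (BoundedContinuousFunction X ℝ) :=
    {f | (∀ x, |f x| ≤ B) ∧ ∀ x y, |f x - f y| ≤ ρ x y} with hA
  have hmod : ∀ x₀ : X, ∀ r > 0, ∀ᶠ x in 𝓝 x₀, ρ x₀ x < r := by
    intro x₀ r hr
    have : Continuous fun x => ρ x₀ x := hρ.comp (by fun_prop : Continuous fun x => (x₀, x))
    exact this.continuousAt.eventually_lt continuousAt_const (by rw [hρ0]; exact hr)
  have hcomp : IsCompact (closure A) := by
    refine BoundedContinuousFunction.arzela_ascoli (Set.Icc (-B) B) isCompact_Icc A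
      (fun f x hf => abs_le.1 (hf.1 x)) fun x₀ => ?_
    rw [Metric.equicontinuousAt_iff_right]
    intro r hr
    filter_upwards [hmod x₀ r hr] with x hx f
    exact (f.2.2 x₀ x).trans_lt hx
  have htb : TotallyBounded A := hcomp.totallyBounded.subset subset_closure
  obtain ⟨t, -, ht, htA⟩ := Metric.finite_approx_of_totallyBounded htb δ hδ
  refine ⟨ht.toFinset.image fun f => f.toContinuousMap, fun f hfB hfρ => ?_⟩
  -- Continuity is not assumed of `f`; it follows from the modulus `ρ`, which is continuous and
  -- vanishes on the diagonal.
  have hfc : Continuous f := by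
    rw [continuous_iff_continuousAt]
    intro x₀
    rw [Metric.continuousAt_iff']
    intro r hr
    filter_upwards [hmod x₀ r hr] with x hx
    rw [dist_comm]
    exact (hfρ x₀ x).trans_lt hx
  have hf : BoundedContinuousFunction.mkOfCompact ⟨f, hfc⟩ ∈ A := ⟨hfB, hfρ⟩
  obtain ⟨g, hg, hfg⟩ := Set.mem_iUnion₂.1 (htA hf)
  refine ⟨g.toContinuousMap, Finset.mem_image_of_mem _ (ht.mem_toFinset.2 hg), fun x => ?_⟩
  exact (BoundedContinuousFunction.dist_coe_le_dist x).trans (Metric.mem_ball.1 hfg).le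

theorem abs_integral_le {Y : Type*} [MeasurableSpace Y] {κ : Measure Y} [IsProbabilityMeasure κ]
    {f : Y → ℝ} {B : ℝ} (hf : ∀ y, |f y| ≤ B) : |∫ y, f y ∂κ| ≤ B := by
  simpa using norm_integral_le_of_norm_le_const (μ := κ) (f := f) (Eventually.of_forall hf)

/-- The integral probability metric of a family of test functions. -/
noncomputable def ipm {X ι : Type*} [MeasurableSpace X] (f : ι → X → ℝ) (μ ν : Measure X) : ℝ :=
  ⨆ i, (∫ x, f i x ∂μ - ∫ x, f i x ∂ν)

/-- A family of continuous functions that is totally bounded in the uniform norm, up to additive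
constants. -/
structure IsTotallyBoundedFamily {X ι : Type*} [TopologicalSpace X] (f : ι → X → ℝ) : Prop where
  continuous (i : ι) : Continuous (f i)
  exists_net {δ : ℝ} (hδ : 0 < δ) :
    ∃ G : Finset C(X, ℝ), ∀ i, ∃ g ∈ G, ∃ b : ℝ, ∀ x, |f i x - b - g x| ≤ δ

theorem integrable_of_continuous {X : Type*} [TopologicalSpace X] [CompactSpace X]
    [MeasurableSpace X] [OpensMeasurableSpace X] {μ : Measure X} [IsFiniteMeasure μ]
    {f : X → ℝ} (hf : Continuous f) : Integrable f μ :=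
  (BoundedContinuousFunction.mkOfCompact ⟨f, hf⟩).integrable μ

namespace IsTotallyBoundedFamily

variable {X ι : Type*} [TopologicalSpace X] [CompactSpace X] [MeasurableSpace X]
  [OpensMeasurableSpace X] {f : ι → X → ℝ}

/-- The constant `b` cancels between two probability measures, and uniform approximation within δ/2
costs δ/2 for each of them. Summing over the whole net makes the bound independent of `i`. -/
theorem exists_sub_le (h : IsTotallyBoundedFamily f) {δ : ℝ} (hδ : 0 < δ) :
    ∃ G : Finset C(X, ℝ), ∀ (μ ν : Measure X) [IsProbabilityMeasure μ] [IsProbabilityMeasure ν] (i),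
      ∫ x, f i x ∂μ - ∫ x, f i x ∂ν ≤ δ + ∑ g ∈ G, |∫ x, g x ∂μ - ∫ x, g x ∂ν| := by
  obtain ⟨G, hG⟩ := h.exists_net (half_pos hδ)
  refine ⟨G, fun μ ν _ _ i => ?_⟩
  obtain ⟨g, hg, b, hb⟩ := hG i
  have key : ∀ (κ : Measure X) [IsProbabilityMeasure κ],
      |∫ x, f i x ∂κ - b - ∫ x, g x ∂κ| ≤ δ / 2 := by
    intro κ _
    have h1 : ∫ x, f i x ∂κ - b - ∫ x, g x ∂κ = ∫ x, (f i x - b - g x) ∂κ := by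
      have hi := integrable_of_continuous (μ := κ) (h.continuous i)
      rw [integral_sub (f := fun x => f i x - b) (hi.sub (integrable_const b))
        (integrable_of_continuous g.continuous),
        integral_sub hi (integrable_const b)]
      simp
    rw [h1]
    exact abs_integral_le hb
  have h1 := abs_le.1 (key μ)
  have h2 := abs_le.1 (key ν)
  have h3 : |∫ x, g x ∂μ - ∫ x, g x ∂ν| ≤ ∑ g ∈ G, |∫ x, g x ∂μ - ∫ x, g x ∂ν| :=
    Finset.single_le_sum (f := fun g : C(X, ℝ) => |∫ x, g x ∂μ - ∫ x, g x ∂ν|)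
      (fun _ _ => abs_nonneg _) hg
  have h4 := le_abs_self (∫ x, g x ∂μ - ∫ x, g x ∂ν)
  linarith [h1.1, h1.2, h2.1, h2.2]

variable {μ ν κ : Measure X} [IsProbabilityMeasure μ] [IsProbabilityMeasure ν]
  [IsProbabilityMeasure κ]

/-- A real supremum defaults to 0 when the set is unbounded above, so this is what gives `ipm` its
intended meaning. -/
theorem bddAbove (h : IsTotallyBoundedFamily f) :
    BddAbove (Set.range fun i => ∫ x, f i x ∂μ - ∫ x, f i x ∂ν) := by
  obtain ⟨G, hG⟩ := h.exists_sub_le one_pos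
  exact ⟨_, Set.forall_mem_range.2 (hG μ ν)⟩

theorem sub_le_ipm (h : IsTotallyBoundedFamily f) (i : ι) :
    ∫ x, f i x ∂μ - ∫ x, f i x ∂ν ≤ ipm f μ ν :=
  le_ciSup h.bddAbove i

theorem ipm_triangle [Nonempty ι] (h : IsTotallyBoundedFamily f) :
    ipm f μ κ ≤ ipm f μ ν + ipm f ν κ := by
  refine ciSup_le fun i => ?_
  linarith [h.sub_le_ipm (μ := μ) (ν := ν) i, h.sub_le_ipm (μ := ν) (ν := κ) i]

theorem exists_ipm_le [Nonempty ι] (h : IsTotallyBoundedFamily f) {δ : ℝ} (hδ : 0 < δ) :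
    ∃ G : Finset C(X, ℝ), ∀ (μ ν : Measure X) [IsProbabilityMeasure μ] [IsProbabilityMeasure ν],
      ipm f μ ν ≤ δ + ∑ g ∈ G, |∫ x, g x ∂μ - ∫ x, g x ∂ν| := by
  obtain ⟨G, hG⟩ := h.exists_sub_le hδ
  exact ⟨G, fun μ ν _ _ => ciSup_le (hG μ ν)⟩

/-- The index set may be uncountable, but a supremum of continuous functions of ω is lower
semicontinuous, hence Borel. -/
theorem measurable_ipm {Ω : Type*} [TopologicalSpace Ω] [MeasurableSpace Ω]
    [OpensMeasurableSpace Ω] (h : IsTotallyBoundedFamily f) {η : Ω → Measure X}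
    [∀ ω, IsProbabilityMeasure (η ω)]
    (hη : ∀ g : C(X, ℝ), Continuous fun ω => ∫ x, g x ∂η ω) : Measurable fun ω => ipm f μ (η ω) :=
  (lowerSemicontinuous_ciSup (fun _ => h.bddAbove) fun i =>
    (continuous_const.sub (hη ⟨f i, h.continuous i⟩)).lowerSemicontinuous).measurable

end IsTotallyBoundedFamily

/-! ### The Wasserstein distance, the maximum mean discrepancy and their sum -/

/-- Lipschitz functions are bounded only after a normalization: subtracting the value at a base
point leaves a function bounded by the diameter. This is why nets are taken up to additive
constants. -/
theorem isTotallyBoundedFamily_lipschitz {X : Type*} [MetricSpace X] [CompactSpace X] :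
    IsTotallyBoundedFamily fun D : {D : X → ℝ // LipschitzWith 1 D} => D.1 where
  continuous D := D.2.continuous
  exists_net {δ} hδ := by
    obtain ⟨G, hG⟩ := exists_finset_net (X := X) (ρ := dist) continuous_dist dist_self
      (Metric.diam (Set.univ : Set X)) hδ
    rcases isEmpty_or_nonempty X with hX | ⟨⟨x₀⟩⟩
    · exact ⟨{0}, fun _ => ⟨0, by simp, 0, fun x => hX.elim x⟩⟩
    refine ⟨G, fun D => ?_⟩
    have hD : ∀ x y, |D.1 x - D.1 y| ≤ dist x y := fun x y => by
      simpa [Real.dist_eq] using D.2.dist_le_mul x y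
    obtain ⟨g, hg, hgD⟩ := hG (fun x => D.1 x - D.1 x₀)
      (fun x => (hD x x₀).trans
        (Metric.dist_le_diam_of_mem isCompact_univ.isBounded trivial trivial))
      fun x y => by simpa using hD x y
    exact ⟨g, hg, D.1 x₀, hgD⟩

section RKHS

variable {X : Type*} {𝓗 : Type*} [NormedAddCommGroup 𝓗] [InnerProductSpace ℝ 𝓗]
  [CompleteSpace 𝓗] [RKHS ℝ 𝓗 X ℝ]

theorem rkhs_apply (h : 𝓗) (x : X) : h x = inner ℝ h (RKHS.kerFun 𝓗 x 1) := by simp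

theorem kernelFn_eq_inner (x y : X) :
    kernelFn 𝓗 x y = inner ℝ (RKHS.kerFun 𝓗 y 1) (RKHS.kerFun 𝓗 x (1 : ℝ)) := by
  rw [← RKHS.kernel_inner]
  simp [kernelFn]

theorem norm_kerFun_sub_sq (x y : X) :
    ‖RKHS.kerFun 𝓗 x (1 : ℝ) - RKHS.kerFun 𝓗 y 1‖ ^ 2 =
      kernelFn 𝓗 x x - 2 * kernelFn 𝓗 x y + kernelFn 𝓗 y y := by
  rw [norm_sub_sq_real, kernelFn_eq_inner, kernelFn_eq_inner, kernelFn_eq_inner,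
    real_inner_self_eq_norm_sq, real_inner_self_eq_norm_sq, real_inner_comm]

/-- Cauchy–Schwarz applied to the difference of the kernel sections at `x` and `y`. The right side
is a continuous modulus shared by the whole unit ball. -/
theorem abs_rkhs_apply_sub_le {h : 𝓗} (hh : ‖h‖ ≤ 1) (x y : X) :
    |h x - h y| ≤ √(kernelFn 𝓗 x x - 2 * kernelFn 𝓗 x y + kernelFn 𝓗 y y) := by
  rw [← norm_kerFun_sub_sq, Real.sqrt_sq (norm_nonneg _), rkhs_apply, rkhs_apply, ← inner_sub_right]
  refine (abs_real_inner_le_norm _ _).trans ?_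
  exact mul_le_of_le_one_left (norm_nonneg _) hh

theorem abs_rkhs_apply_le {h : 𝓗} (hh : ‖h‖ ≤ 1) {K : ℝ} (hK : ∀ x y : X, |kernelFn 𝓗 x y| < K)
    (x : X) : |h x| ≤ √K := by
  have h1 : ‖RKHS.kerFun 𝓗 x (1 : ℝ)‖ ≤ √K := by
    refine Real.le_sqrt_of_sq_le ?_
    rw [← real_inner_self_eq_norm_sq, ← kernelFn_eq_inner]
    exact (le_abs_self _).trans (hK x x).le
  rw [rkhs_apply]
  refine (abs_real_inner_le_norm _ _).trans ?_
  exact (mul_le_of_le_one_left (norm_nonneg _) hh).trans h1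

theorem isTotallyBoundedFamily_rkhs [TopologicalSpace X] [CompactSpace X]
    (hk : Continuous fun p : X × X => kernelFn 𝓗 p.1 p.2) {K : ℝ}
    (hK : ∀ x y : X, |kernelFn 𝓗 x y| < K) :
    IsTotallyBoundedFamily fun (h : {h : 𝓗 // ‖h‖ ≤ 1}) (x : X) => h.1 x := by
  set ρ : X → X → ℝ := fun x y =>
    √(kernelFn 𝓗 x x - 2 * kernelFn 𝓗 x y + kernelFn 𝓗 y y) with hρ
  have hdiag : Continuous fun x : X => kernelFn 𝓗 x x :=
    Continuous.comp (g := fun p : X × X => kernelFn 𝓗 p.1 p.2) (f := fun x => (x, x)) hk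
      (continuous_id.prodMk continuous_id)
  have hρc : Continuous (Function.uncurry ρ) := by
    refine Real.continuous_sqrt.comp ?_
    exact ((hdiag.comp continuous_fst).sub (hk.const_mul 2)).add (hdiag.comp continuous_snd)
  have hρ0 : ∀ x, ρ x x = 0 := fun x => by
    have : kernelFn 𝓗 x x - 2 * kernelFn 𝓗 x x + kernelFn 𝓗 x x = 0 := by ring
    simp [hρ, this]
  refine ⟨fun h => ?_, fun {δ} hδ => ?_⟩
  · rw [continuous_iff_continuousAt]
    intro x₀
    rw [ContinuousAt, tendsto_iff_dist_tendsto_zero]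
    refine squeeze_zero (fun _ => dist_nonneg) (fun x => abs_rkhs_apply_sub_le h.2 x x₀) ?_
    have h1 : Continuous fun x => ρ x x₀ := 
      hρc.comp (f := fun x => (x, x₀)) (by fun_prop)
    have h2 := h1.tendsto x₀
    rwa [hρ0] at h2
  · obtain ⟨G, hG⟩ := exists_finset_net hρc hρ0 (√K) hδ
    refine ⟨G, fun h => ?_⟩
    obtain ⟨g, hg, hgh⟩ := hG (fun x => h.1 x) (abs_rkhs_apply_le h.2 hK)
      (abs_rkhs_apply_sub_le h.2)
    exact ⟨g, hg, 0, by simpa using hgh⟩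

end RKHS

theorem abs_le_add_sq {η : ℝ} (hη : 0 < η) (x : ℝ) : |x| ≤ η + η⁻¹ * x ^ 2 := by
  have h1 : 0 ≤ η⁻¹ * (|x| - η) ^ 2 := by positivity
  have h2 : η⁻¹ * (|x| - η) ^ 2 = η⁻¹ * x ^ 2 - 2 * |x| + η := by
    rw [sub_sq, sq_abs]; field_simp
  linarith [abs_nonneg x]

/-- Trades absolute errors for squared ones, whose means are accessible through variances. The
constant `M` blows up as δ → 0, which is harmless because δ stays fixed while n, N → ∞. -/
theorem exists_sum_abs_le_add_sum_sq {ι : Type*} (G : Finset ι) {δ : ℝ} (hδ : 0 < δ) :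
    ∃ M : ℝ, 0 ≤ M ∧ ∀ x : ι → ℝ, ∑ g ∈ G, |x g| ≤ δ + M * ∑ g ∈ G, x g ^ 2 := by
  -- An equal share of δ for each term; the `+ 1` covers an empty `G`.
  have hη : 0 < δ / (G.card + 1) := by positivity
  refine ⟨(δ / (G.card + 1))⁻¹, by positivity, fun x => ?_⟩
  calc ∑ g ∈ G, |x g| ≤ ∑ g ∈ G, (δ / (G.card + 1) + (δ / (G.card + 1))⁻¹ * x g ^ 2) :=
        Finset.sum_le_sum fun g _ => abs_le_add_sq hη _
    _ = G.card * (δ / (G.card + 1)) + (δ / (G.card + 1))⁻¹ * ∑ g ∈ G, x g ^ 2 := by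
        rw [Finset.sum_add_distrib, Finset.mul_sum, Finset.sum_const, nsmul_eq_mul]
    _ ≤ _ := by
        gcongr
        rw [mul_div_assoc', div_le_iff₀ (by positivity)]
        nlinarith

theorem wmmd_eq_ipm_add_ipm {X : Type*} [MetricSpace X] [MeasurableSpace X] {𝓗 : Type*}
    [NormedAddCommGroup 𝓗] [InnerProductSpace ℝ 𝓗] [RKHS ℝ 𝓗 X ℝ] (μ ν : Measure X) :
    wmmd 𝓗 μ ν = ipm (fun D : {D : X → ℝ // LipschitzWith 1 D} => D.1) μ ν +
      ipm (fun (h : {h : 𝓗 // ‖h‖ ≤ 1}) (x : X) => h.1 x) μ ν := rfl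

section WMMD

variable {X : Type*} [MetricSpace X] [CompactSpace X] [MeasurableSpace X] [BorelSpace X]
  {𝓗 : Type*} [NormedAddCommGroup 𝓗] [InnerProductSpace ℝ 𝓗] [CompleteSpace 𝓗] [RKHS ℝ 𝓗 X ℝ]
  {K : ℝ}

instance : Nonempty {D : X → ℝ // LipschitzWith 1 D} :=
  ⟨⟨fun _ => 0, LipschitzWith.const' 0⟩⟩

instance : Nonempty {h : 𝓗 // ‖h‖ ≤ 1} := ⟨⟨0, by simp⟩⟩

theorem wmmd_triangle (hk : Continuous fun p : X × X => kernelFn 𝓗 p.1 p.2)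
    (hK : ∀ x y : X, |kernelFn 𝓗 x y| < K) (μ ν κ : Measure X) [IsProbabilityMeasure μ]
    [IsProbabilityMeasure ν] [IsProbabilityMeasure κ] :
    wmmd 𝓗 μ κ ≤ wmmd 𝓗 μ ν + wmmd 𝓗 ν κ := by
  simp only [wmmd_eq_ipm_add_ipm]
  linarith [isTotallyBoundedFamily_lipschitz.ipm_triangle (μ := μ) (ν := ν) (κ := κ),
    (isTotallyBoundedFamily_rkhs hk hK).ipm_triangle (μ := μ) (ν := ν) (κ := κ)]

theorem wmmd_nonneg (hk : Continuous fun p : X × X => kernelFn 𝓗 p.1 p.2)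
    (hK : ∀ x y : X, |kernelFn 𝓗 x y| < K) (μ ν : Measure X) [IsProbabilityMeasure μ]
    [IsProbabilityMeasure ν] : 0 ≤ wmmd 𝓗 μ ν := by
  have h1 := isTotallyBoundedFamily_lipschitz.sub_le_ipm (μ := μ) (ν := ν)
    ⟨fun _ => 0, LipschitzWith.const' 0⟩
  have h2 := (isTotallyBoundedFamily_rkhs hk hK).sub_le_ipm (μ := μ) (ν := ν) ⟨0, by simp⟩
  simp only [integral_zero, sub_self, RKHS.coe_zero, Pi.zero_apply] at h1 h2
  exact add_nonneg h1 h2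

/-- Up to a small error, `wmmd` is controlled by finitely many continuous test functions. -/
theorem exists_wmmd_le_sum_abs (hk : Continuous fun p : X × X => kernelFn 𝓗 p.1 p.2)
    (hK : ∀ x y : X, |kernelFn 𝓗 x y| < K) {δ : ℝ} (hδ : 0 < δ) :
    ∃ G : Finset C(X, ℝ), ∀ (μ ν : Measure X) [IsProbabilityMeasure μ] [IsProbabilityMeasure ν],
      wmmd 𝓗 μ ν ≤ δ + 2 * ∑ g ∈ G, |∫ x, g x ∂μ - ∫ x, g x ∂ν| := by
  classical
  obtain ⟨G₁, hG₁⟩ := isTotallyBoundedFamily_lipschitz.exists_ipm_le (X := X) (half_pos hδ)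
  obtain ⟨G₂, hG₂⟩ := (isTotallyBoundedFamily_rkhs hk hK).exists_ipm_le (half_pos hδ)
  refine ⟨G₁ ∪ G₂, fun μ ν _ _ => ?_⟩
  rw [wmmd_eq_ipm_add_ipm]
  have h1 : ∑ g ∈ G₁, |∫ x, g x ∂μ - ∫ x, g x ∂ν| ≤ ∑ g ∈ G₁ ∪ G₂, |∫ x, g x ∂μ - ∫ x, g x ∂ν| :=
    Finset.sum_le_sum_of_subset_of_nonneg Finset.subset_union_left fun _ _ _ => abs_nonneg _
  have h2 : ∑ g ∈ G₂, |∫ x, g x ∂μ - ∫ x, g x ∂ν| ≤ ∑ g ∈ G₁ ∪ G₂, |∫ x, g x ∂μ - ∫ x, g x ∂ν| :=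
    Finset.sum_le_sum_of_subset_of_nonneg Finset.subset_union_right fun _ _ _ => abs_nonneg _
  linarith [hG₁ μ ν, hG₂ μ ν]

theorem exists_wmmd_le_sum_sq (hk : Continuous fun p : X × X => kernelFn 𝓗 p.1 p.2)
    (hK : ∀ x y : X, |kernelFn 𝓗 x y| < K) {δ : ℝ} (hδ : 0 < δ) :
    ∃ (G : Finset C(X, ℝ)) (M : ℝ), 0 ≤ M ∧
      ∀ (μ ν : Measure X) [IsProbabilityMeasure μ] [IsProbabilityMeasure ν],
        wmmd 𝓗 μ ν ≤ δ + M * ∑ g ∈ G, (∫ x, g x ∂μ - ∫ x, g x ∂ν) ^ 2 := by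
  obtain ⟨G, hG⟩ := exists_wmmd_le_sum_abs hk hK (half_pos hδ)
  obtain ⟨M, hM, hGM⟩ := exists_sum_abs_le_add_sum_sq G (by positivity : 0 < δ / 4)
  refine ⟨G, 2 * M, by positivity, fun μ ν _ _ => ?_⟩
  linarith [hG μ ν, hGM fun g => ∫ x, g x ∂μ - ∫ x, g x ∂ν]

theorem measurable_wmmd {Ω : Type*} [TopologicalSpace Ω] [MeasurableSpace Ω]
    [OpensMeasurableSpace Ω] (hk : Continuous fun p : X × X => kernelFn 𝓗 p.1 p.2)
    (hK : ∀ x y : X, |kernelFn 𝓗 x y| < K) (μ : Measure X) [IsProbabilityMeasure μ]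
    {η : Ω → Measure X} [∀ ω, IsProbabilityMeasure (η ω)]
    (hη : ∀ g : C(X, ℝ), Continuous fun ω => ∫ x, g x ∂η ω) :
    Measurable fun ω => wmmd 𝓗 μ (η ω) :=
  (isTotallyBoundedFamily_lipschitz.measurable_ipm hη).add
    ((isTotallyBoundedFamily_rkhs hk hK).measurable_ipm hη)

theorem exists_wmmd_le (hk : Continuous fun p : X × X => kernelFn 𝓗 p.1 p.2)
    (hK : ∀ x y : X, |kernelFn 𝓗 x y| < K) :
    ∃ B : ℝ, ∀ (μ ν : Measure X) [IsProbabilityMeasure μ] [IsProbabilityMeasure ν],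
      wmmd 𝓗 μ ν ≤ B := by
  obtain ⟨G, hG⟩ := exists_wmmd_le_sum_abs hk hK one_pos
  refine ⟨1 + 2 * ∑ g ∈ G, (‖g‖ + ‖g‖), fun μ ν _ _ => (hG μ ν).trans ?_⟩
  gcongr with g
  have key : ∀ (κ : Measure X) [IsProbabilityMeasure κ], |∫ x, g x ∂κ| ≤ ‖g‖ := fun κ _ =>
    abs_integral_le g.norm_coe_le_norm
  exact (abs_sub _ _).trans (add_le_add (key μ) (key ν))

/-! ### Huber contamination -/

theorem isProbabilityMeasure_smul_add_smul {Y : Type*} [MeasurableSpace Y] {r s : ℝ} (hr : 0 ≤ r)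
    (hs : 0 ≤ s) (hrs : r + s = 1) (μ ν : Measure Y) [IsProbabilityMeasure μ]
    [IsProbabilityMeasure ν] :
    IsProbabilityMeasure (ENNReal.ofReal r • μ + ENNReal.ofReal s • ν) where
  measure_univ := by simp [← ENNReal.ofReal_add hr hs, hrs]

theorem integral_smul_add_smul {Y : Type*} [MeasurableSpace Y] {r s : ℝ} (hr : 0 ≤ r)
    (hs : 0 ≤ s) {μ ν : Measure Y} {f : Y → ℝ} (hμ : Integrable f μ) (hν : Integrable f ν) :
    ∫ y, f y ∂(ENNReal.ofReal r • μ + ENNReal.ofReal s • ν) =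
      r * ∫ y, f y ∂μ + s * ∫ y, f y ∂ν := by
  rw [integral_add_measure (hμ.smul_measure ENNReal.ofReal_ne_top)
    (hν.smul_measure ENNReal.ofReal_ne_top), integral_smul_measure, integral_smul_measure]
  simp [ENNReal.toReal_ofReal, hr, hs]

theorem isProbabilityMeasure_huberMixture {Y : Type*} [MeasurableSpace Y] {ε : ℝ}
    (h0 : 0 ≤ ε) (h1 : ε ≤ 1) (μ ν : Measure Y) [IsProbabilityMeasure μ]
    [IsProbabilityMeasure ν] : IsProbabilityMeasure (huberMixture ε μ ν) :=
  isProbabilityMeasure_smul_add_smul (by linarith) h0 (by ring) μ ν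

theorem isProbabilityMeasure_huberPair {Y : Type*} [MeasurableSpace Y] {ε : ℝ}
    (h0 : 0 ≤ ε) (h1 : ε ≤ 1) (μ ν : Measure Y) [IsProbabilityMeasure μ]
    [IsProbabilityMeasure ν] : IsProbabilityMeasure (huberPair ε μ ν) :=
  isProbabilityMeasure_smul_add_smul (by linarith) h0 (by ring) _ _

theorem map_snd_huberPair {Y : Type*} [MeasurableSpace Y] (ε : ℝ) (μ ν : Measure Y)
    [IsProbabilityMeasure μ] [IsProbabilityMeasure ν] :
    (huberPair ε μ ν).map Prod.snd = huberMixture ε μ ν := by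
  rw [huberPair, huberMixture, Measure.map_add _ _ measurable_snd, Measure.map_smul,
    Measure.map_smul, Measure.map_snd_prod, Measure.map_snd_prod]
  simp

/-- Every test function sees the gap between `μ` and the mixture as ε times the gap between `μ` and
`ν`. On the unit ball of the RKHS that gap is at most 2√K, because each `h` is bounded by √K. -/
theorem wmmd_huberMixture_le (hk : Continuous fun p : X × X => kernelFn 𝓗 p.1 p.2)
    (hK : ∀ x y : X, |kernelFn 𝓗 x y| < K) {ε : ℝ} (h0 : 0 ≤ ε) (h1 : ε ≤ 1)
    (μ ν : Measure X) [IsProbabilityMeasure μ] [IsProbabilityMeasure ν] :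
    wmmd 𝓗 μ (huberMixture ε μ ν) ≤ (2 * √K + wasserstein μ ν) * ε := by
  have hmix : ∀ {f : X → ℝ}, Continuous f →
      ∫ x, f x ∂μ - ∫ x, f x ∂(huberMixture ε μ ν) = ε * (∫ x, f x ∂μ - ∫ x, f x ∂ν) := by
    intro f hf
    rw [huberMixture, integral_smul_add_smul (by linarith) h0 (integrable_of_continuous hf)
      (integrable_of_continuous hf)]
    ring
  have hW : ipm (fun D : {D : X → ℝ // LipschitzWith 1 D} => D.1) μ (huberMixture ε μ ν) ≤
      ε * wasserstein μ ν := by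
    refine ciSup_le fun D => ?_
    rw [hmix D.2.continuous]
    exact mul_le_mul_of_nonneg_left (isTotallyBoundedFamily_lipschitz.sub_le_ipm D) h0
  have hM : ipm (fun (h : {h : 𝓗 // ‖h‖ ≤ 1}) (x : X) => h.1 x) μ (huberMixture ε μ ν) ≤
      ε * (2 * √K) := by
    refine ciSup_le fun h => ?_
    rw [hmix ((isTotallyBoundedFamily_rkhs hk hK).continuous h)]
    refine mul_le_mul_of_nonneg_left ?_ h0
    have key : ∀ (κ : Measure X) [IsProbabilityMeasure κ], |∫ x, h.1 x ∂κ| ≤ √K := fun κ _ =>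
      abs_integral_le (abs_rkhs_apply_le h.2 hK)
    linarith [abs_le.1 (key μ), abs_le.1 (key ν)]
  rw [wmmd_eq_ipm_add_ipm]
  linarith

end WMMD

/-! ### Weighted sums of independent random variables -/

theorem integrable_of_measurable_of_abs_le {Y : Type*} [MeasurableSpace Y] {κ : Measure Y}
    [IsFiniteMeasure κ] {f : Y → ℝ} {B : ℝ} (hf : Measurable f) (hB : ∀ y, |f y| ≤ B) :
    Integrable f κ :=
  Integrable.of_bound hf.aestronglyMeasurable B (Eventually.of_forall hB)

theorem variance_le_of_abs_le {Y : Type*} [MeasurableSpace Y] {κ : Measure Y}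
    [IsProbabilityMeasure κ] {f : Y → ℝ} {B : ℝ} (hf : Measurable f) (hB : ∀ y, |f y| ≤ B) :
    Var[f; κ] ≤ B ^ 2 := by
  refine (variance_le_expectation_sq hf.aestronglyMeasurable).trans ?_
  refine (le_abs_self _).trans (abs_integral_le fun y => ?_)
  rw [Pi.pow_apply, abs_pow]
  exact pow_le_pow_left₀ (abs_nonneg _) (hB y) 2

/-- By independence the variance of the weighted sum is ∑ wᵢ² Var f. The weights are deterministic
here; the Dirichlet weights enter by conditioning. -/
theorem lintegral_sq_sum_mul_sub_le {Y : Type*} [MeasurableSpace Y] (κ : Measure Y)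
    [IsProbabilityMeasure κ] {f : Y → ℝ} {B : ℝ} (hf : Measurable f) (hB : ∀ y, |f y| ≤ B)
    {N : ℕ} (w : Fin N → ℝ) :
    ∫⁻ y, ENNReal.ofReal ((∑ i, w i * f (y i) - (∑ i, w i) * ∫ x, f x ∂κ) ^ 2)
      ∂(Measure.pi fun _ : Fin N => κ) ≤ ENNReal.ofReal (B ^ 2 * ∑ i, w i ^ 2) := by
  have hmem : ∀ i : Fin N, MemLp (fun y => w i * f y) 2 κ := fun i =>
    (MemLp.of_bound hf.aestronglyMeasurable B (Eventually.of_forall hB)).const_mul (w i)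
  have hmem' : ∀ i : Fin N, MemLp (fun y : Fin N → Y => w i * f (y i)) 2
      (Measure.pi fun _ : Fin N => κ) := fun i =>
    (hmem i).comp_measurePreserving (measurePreserving_eval (fun _ : Fin N => κ) i)
  have hsum : MemLp (∑ i, fun y : Fin N → Y => w i * f (y i)) 2
      (Measure.pi fun _ : Fin N => κ) := memLp_finsetSum' _ fun i _ => hmem' i
  have hvar := variance_sum_pi (μ := fun _ : Fin N => κ) hmem
  have hE : ∫ y, (∑ i, fun y : Fin N → Y => w i * f (y i)) y ∂(Measure.pi fun _ : Fin N => κ) =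
      (∑ i, w i) * ∫ x, f x ∂κ := by
    simp only [Finset.sum_apply]
    rw [integral_finsetSum _ fun i _ => (hmem' i).integrable (by norm_num), Finset.sum_mul]
    refine Finset.sum_congr rfl fun i _ => ?_
    rw [integral_const_mul, integral_comp_eval (μ := fun _ : Fin N => κ) hf.aestronglyMeasurable]
  have h1 := evariance_eq_lintegral_ofReal (∑ i, fun y : Fin N → Y => w i * f (y i))
    (Measure.pi fun _ : Fin N => κ)
  rw [hE, ← hsum.ofReal_variance_eq, hvar] at h1
  simp only [Finset.sum_apply] at h1
  rw [← h1]
  refine ENNReal.ofReal_le_ofReal ?_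
  rw [Finset.mul_sum]
  refine Finset.sum_le_sum fun i _ => ?_
  rw [variance_const_mul, mul_comm]
  exact mul_le_mul_of_nonneg_right (variance_le_of_abs_le hf hB) (sq_nonneg _)

/-! ### Atomic measures -/

section Atomic

variable {Y : Type*} [MeasurableSpace Y] {N : ℕ}

theorem empirical_eq_weightedAtoms (x : Fin N → Y) :
    empirical x = weightedAtoms (fun _ => 1 / (N : ℝ)) x := by
  rw [empirical, weightedAtoms, Finset.smul_sum]

theorem isProbabilityMeasure_weightedAtoms {w : Fin N → ℝ} (h0 : ∀ i, 0 ≤ w i)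
    (h1 : ∑ i, w i = 1) (x : Fin N → Y) : IsProbabilityMeasure (weightedAtoms w x) where
  measure_univ := by
    simp [weightedAtoms, ← ENNReal.ofReal_sum_of_nonneg fun i _ => h0 i, h1]

theorem integral_weightedAtoms {w : Fin N → ℝ} (h0 : ∀ i, 0 ≤ w i) (x : Fin N → Y) {f : Y → ℝ}
    (hf : Measurable f) : ∫ y, f y ∂(weightedAtoms w x) = ∑ i, w i * f (x i) := by
  have hi : ∀ i, Integrable f (Measure.dirac (x i)) := fun i =>
    ⟨hf.aestronglyMeasurable, by simp [HasFiniteIntegral, lintegral_dirac' _ hf.enorm]⟩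
  rw [weightedAtoms, integral_finsetSum_measure
    fun i _ => (hi i).smul_measure ENNReal.ofReal_ne_top]
  refine Finset.sum_congr rfl fun i _ => ?_
  rw [integral_smul_measure, integral_dirac' _ _ hf.stronglyMeasurable,
    ENNReal.toReal_ofReal (h0 i), smul_eq_mul]

theorem isProbabilityMeasure_empirical (hN : 0 < N) (x : Fin N → Y) :
    IsProbabilityMeasure (empirical x) := by
  rw [empirical_eq_weightedAtoms]
  refine isProbabilityMeasure_weightedAtoms (fun _ => by positivity) ?_ x
  have : (N : ℝ) ≠ 0 := by positivity
  simp [this]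

theorem integral_empirical (x : Fin N → Y) {f : Y → ℝ} (hf : Measurable f) :
    ∫ y, f y ∂(empirical x) = ∑ i, 1 / (N : ℝ) * f (x i) := by
  rw [empirical_eq_weightedAtoms, integral_weightedAtoms (fun _ => by positivity) x hf]

theorem lintegral_sq_empirical_sub_le (κ : Measure Y) [IsProbabilityMeasure κ] {f : Y → ℝ} {B : ℝ}
    (hf : Measurable f) (hB : ∀ y, |f y| ≤ B) (hN : 0 < N) :
    ∫⁻ x : Fin N → Y, ENNReal.ofReal ((∫ y, f y ∂(empirical x) - ∫ y, f y ∂κ) ^ 2)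
      ∂(Measure.pi fun _ : Fin N => κ) ≤ ENNReal.ofReal (B ^ 2 / N) := by
  have hN' : (N : ℝ) ≠ 0 := by positivity
  have h := lintegral_sq_sum_mul_sub_le κ hf hB fun _ : Fin N => 1 / (N : ℝ)
  simp only [integral_empirical _ hf]
  have h1 : ∑ _i : Fin N, 1 / (N : ℝ) = 1 := by simp [hN']
  have h2 : B ^ 2 * ∑ _i : Fin N, (1 / (N : ℝ)) ^ 2 = B ^ 2 / N := by
    simp only [Finset.sum_const, Finset.card_univ, Fintype.card_fin, nsmul_eq_mul]
    field_simp
  simpa only [h1, h2, one_mul] using h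

end Atomic

/-! ### Gamma and Dirichlet distributions -/

/-- Multiplying the Gamma(α) density by `x ^ k` gives a multiple of the integrand of Γ(α + k). -/
theorem integrable_pow_gammaMeasure {α : ℝ} (hα : 0 < α) (k : ℕ) :
    Integrable (fun x => x ^ k) (gammaMeasure α 1) ∧
      ∫ x, x ^ k ∂(gammaMeasure α 1) = Real.Gamma (α + k) / Real.Gamma α := by
  have hpdf : Measurable (gammaPDF α 1) := (measurable_gammaPDFReal α 1).ennreal_ofReal
  have hfin : ∀ᵐ x : ℝ, gammaPDF α 1 x < ∞ := Eventually.of_forall fun x => ENNReal.ofReal_lt_top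
  have hfun : (fun x => (gammaPDF α 1 x).toReal • x ^ k) =ᵐ[volume]
      (Set.Ioi (0 : ℝ)).indicator
        fun x => (Real.Gamma α)⁻¹ * (Real.exp (-x) * x ^ (α + k - 1)) := by
    filter_upwards [compl_mem_ae_iff.2 (measure_singleton (0 : ℝ))] with x hx
    rcases lt_or_gt_of_ne (show x ≠ 0 from hx) with h | h
    · simp [gammaPDF_of_neg h, not_lt.2 h.le]
    · have h1 : x ^ (α + k - 1) = x ^ (α - 1) * x ^ k := by
        rw [← Real.rpow_natCast x k, ← Real.rpow_add h]; ring_nf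
      have h2 : (gammaPDF α 1 x).toReal = (Real.Gamma α)⁻¹ * x ^ (α - 1) * Real.exp (-x) := by
        rw [gammaPDF, ENNReal.toReal_ofReal (gammaPDFReal_nonneg hα one_pos x), gammaPDFReal,
          if_pos h.le]
        simp
      rw [Set.indicator_of_mem (show x ∈ Set.Ioi (0 : ℝ) from h), h2, h1, smul_eq_mul]
      ring
  have hG := Real.GammaIntegral_convergent (s := α + k) (by positivity)
  refine ⟨?_, ?_⟩
  · rw [gammaMeasure, integrable_withDensity_iff_integrable_smul' hpdf hfin, integrable_congr hfun,
      integrable_indicator_iff measurableSet_Ioi]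
    exact hG.const_mul _
  · rw [gammaMeasure, integral_withDensity_eq_integral_toReal_smul hpdf hfin,
      integral_congr_ae hfun, integral_indicator measurableSet_Ioi, integral_const_mul,
      ← Real.Gamma_eq_integral (by positivity)]
    ring

theorem integral_gammaMeasure {α : ℝ} (hα : 0 < α) : ∫ x, x ∂(gammaMeasure α 1) = α := by
  have h := (integrable_pow_gammaMeasure hα 1).2
  simp only [pow_one, Nat.cast_one, Real.Gamma_add_one hα.ne'] at h
  rw [h, mul_div_assoc, div_self (Real.Gamma_pos_of_pos hα).ne', mul_one]

theorem integral_sq_gammaMeasure {α : ℝ} (hα : 0 < α) :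
    ∫ x, x ^ 2 ∂(gammaMeasure α 1) = (α + 1) * α := by
  have h := (integrable_pow_gammaMeasure hα 2).2
  rw [h, show α + ((2 : ℕ) : ℝ) = α + 1 + 1 by push_cast; ring, Real.Gamma_add_one (by positivity),
    Real.Gamma_add_one hα.ne', mul_div_assoc, mul_div_assoc,
    div_self (Real.Gamma_pos_of_pos hα).ne', mul_one]

theorem memLp_id_gammaMeasure {α : ℝ} (hα : 0 < α) :
    MemLp (fun x : ℝ => x) 2 (gammaMeasure α 1) :=
  (memLp_two_iff_integrable_sq measurable_id.aestronglyMeasurable).2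
    (integrable_pow_gammaMeasure hα 2).1

theorem variance_gammaMeasure {α : ℝ} (hα : 0 < α) :
    Var[fun x : ℝ => x; gammaMeasure α 1] = α := by
  have := isProbabilityMeasure_gammaMeasure hα one_pos
  rw [variance_eq_sub (memLp_id_gammaMeasure hα), integral_gammaMeasure hα]
  have h : ∫ x, ((fun x : ℝ => x) ^ 2) x ∂(gammaMeasure α 1) = (α + 1) * α :=
    integral_sq_gammaMeasure hα
  rw [h]
  ring

theorem ae_pos_gammaMeasure (α : ℝ) : ∀ᵐ x ∂(gammaMeasure α 1), 0 < x := by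
  have hpdf : Measurable (gammaPDF α 1) := (measurable_gammaPDFReal α 1).ennreal_ofReal
  rw [gammaMeasure, ae_withDensity_iff hpdf]
  filter_upwards [compl_mem_ae_iff.2 (measure_singleton (0 : ℝ))] with x hx hpdf
  rcases lt_or_gt_of_ne (show x ≠ 0 from hx) with h | h
  · exact absurd (gammaPDF_of_neg h) hpdf
  · exact h

section Dirichlet

variable {N : ℕ} {α : Fin N → ℝ}

theorem measurable_div_sum : Measurable fun (g : Fin N → ℝ) i => g i / ∑ j, g j := by
  fun_prop

theorem isProbabilityMeasure_dirichletMeasure (hα : ∀ i, 0 < α i) :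
    IsProbabilityMeasure (dirichletMeasure α) := by
  have := fun i => isProbabilityMeasure_gammaMeasure (hα i) one_pos
  exact Measure.isProbabilityMeasure_map measurable_div_sum.aemeasurable

theorem ae_dirichletMeasure (hN : 0 < N) (hα : ∀ i, 0 < α i) :
    ∀ᵐ J ∂(dirichletMeasure α), (∀ i, 0 ≤ J i) ∧ ∑ i, J i = 1 := by
  have := fun i => isProbabilityMeasure_gammaMeasure (hα i) one_pos
  have : Nonempty (Fin N) := ⟨⟨0, hN⟩⟩
  have hmeas : MeasurableSet {J : Fin N → ℝ | (∀ i, 0 ≤ J i) ∧ ∑ i, J i = 1} := by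
    measurability
  rw [dirichletMeasure, ae_map_iff measurable_div_sum.aemeasurable hmeas]
  have hpos : ∀ᵐ g ∂(Measure.pi fun i => gammaMeasure (α i) 1), ∀ i, 0 < g i :=
    eventually_all.2 fun i => Measure.tendsto_eval_ae_ae.eventually (ae_pos_gammaMeasure (α i))
  filter_upwards [hpos] with g hg
  have hS : 0 < ∑ j, g j := Finset.sum_pos (fun i _ => hg i) Finset.univ_nonempty
  exact ⟨fun i => div_nonneg (hg i).le hS.le, by rw [← Finset.sum_div, div_self hS.ne']⟩

/-- Avoids moments of a ratio. If S ≥ b/2, the denominator S² is at least b²/4 and the first term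
suffices; otherwise the left side is at most 1 while (S - b)² ≥ b²/4. In the application `b` is the
mean of S. -/
theorem sum_sq_div_sum_le {g : Fin N → ℝ} (hg : ∀ i, 0 ≤ g i) {b : ℝ} (hb : 0 < b) :
    ∑ i, (g i / ∑ j, g j) ^ 2 ≤ 4 / b ^ 2 * (∑ i, g i ^ 2 + (∑ i, g i - b) ^ 2) := by
  set S := ∑ j, g j
  have hS : 0 ≤ S := Finset.sum_nonneg fun i _ => hg i
  have hq : 0 ≤ ∑ i, g i ^ 2 := Finset.sum_nonneg fun i _ => sq_nonneg _
  have hqS : ∑ i, g i ^ 2 ≤ S ^ 2 := Finset.sum_sq_le_sq_sum_of_nonneg fun i _ => hg i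
  simp_rw [div_pow, ← Finset.sum_div]
  rw [div_mul_eq_mul_div]
  rcases le_or_gt (b / 2) S with h | h
  · have hS' : 0 < S := by linarith
    rw [div_le_div_iff₀ (by positivity) (by positivity)]
    nlinarith [mul_le_mul_of_nonneg_left (pow_le_pow_left₀ (by positivity) h 2) hq,
      mul_nonneg (sq_nonneg (S - b)) (sq_nonneg S)]
  · refine (div_le_one_of_le₀ hqS (sq_nonneg _)).trans ?_
    rw [one_le_div (by positivity)]
    nlinarith

theorem lintegral_sum_sq_dirichletMeasure_le (hN : 0 < N) {b : ℝ} (hb : 0 < b) :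
    ∫⁻ J, ENNReal.ofReal (∑ i, J i ^ 2) ∂(dirichletMeasure fun _ : Fin N => b / N) ≤
      ENNReal.ofReal (4 / N + 8 / b) := by
  have hN' : (0 : ℝ) < N := by positivity
  have hα : 0 < b / N := by positivity
  have := isProbabilityMeasure_gammaMeasure hα one_pos
  set π : Measure (Fin N → ℝ) := Measure.pi fun _ => gammaMeasure (b / N) 1 with hπ
  have hmem : ∀ i : Fin N, MemLp (fun g : Fin N → ℝ => g i) 2 π := fun i =>
    (memLp_id_gammaMeasure hα).comp_measurePreserving
      (measurePreserving_eval (fun _ : Fin N => gammaMeasure (b / N) 1) i)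
  have hsum : MemLp (∑ i, fun g : Fin N → ℝ => g i) 2 π := memLp_finsetSum' _ fun i _ => hmem i
  have hE : ∫ g, (∑ i, fun g : Fin N → ℝ => g i) g ∂π = b := by
    simp only [Finset.sum_apply]
    rw [integral_finsetSum _ fun i _ => (hmem i).integrable (by norm_num)]
    have : ∀ i : Fin N, ∫ g, g i ∂π = b / N := fun i => by
      rw [hπ, integral_comp_eval (μ := fun _ : Fin N => gammaMeasure (b / N) 1)
        (f := fun x : ℝ => x) measurable_id.aestronglyMeasurable, integral_gammaMeasure hα]
    simp only [this, Finset.sum_const, Finset.card_univ, Fintype.card_fin, nsmul_eq_mul]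
    field_simp
  have hvar : ∫ g, (∑ i, g i - b) ^ 2 ∂π = b := by
    have h := variance_sum_pi (μ := fun _ : Fin N => gammaMeasure (b / N) 1)
      (X := fun _ x => x) fun _ => memLp_id_gammaMeasure hα
    rw [variance_eq_integral hsum.aestronglyMeasurable.aemeasurable, hE] at h
    simp only [Finset.sum_apply, variance_gammaMeasure hα, Finset.sum_const, Finset.card_univ,
      Fintype.card_fin, nsmul_eq_mul] at h
    rw [h]
    field_simp
  have hsqi : ∀ i : Fin N, Integrable (fun g : Fin N → ℝ => g i ^ 2) π := fun i =>
    (hmem i).integrable_sq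
  have hsq : ∫ g, ∑ i, g i ^ 2 ∂π = b * (b / N + 1) := by
    rw [integral_finsetSum _ fun i _ => hsqi i]
    have : ∀ i : Fin N, ∫ g, g i ^ 2 ∂π = (b / N + 1) * (b / N) := fun i => by
      rw [hπ, integral_comp_eval (μ := fun _ : Fin N => gammaMeasure (b / N) 1)
        (f := fun x : ℝ => x ^ 2) (measurable_id.pow_const 2).aestronglyMeasurable,
        integral_sq_gammaMeasure hα]
    simp only [this, Finset.sum_const, Finset.card_univ, Fintype.card_fin, nsmul_eq_mul]
    field_simp
  have hint1 : Integrable (fun g : Fin N → ℝ => ∑ i, g i ^ 2) π :=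
    integrable_finsetSum _ fun i _ => hsqi i
  have hint2 : Integrable (fun g : Fin N → ℝ => (∑ i, g i - b) ^ 2) π := by
    have := (hsum.sub (memLp_const b)).integrable_sq
    simpa using this
  have hint : Integrable (fun g : Fin N → ℝ => ∑ i, g i ^ 2 + (∑ i, g i - b) ^ 2) π :=
    hint1.add hint2
  have hpos : ∀ᵐ g ∂π, ∀ i, 0 < g i :=
    eventually_all.2 fun i => Measure.tendsto_eval_ae_ae.eventually (ae_pos_gammaMeasure (b / N))
  rw [dirichletMeasure, lintegral_map (by fun_prop) measurable_div_sum]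
  calc ∫⁻ g, ENNReal.ofReal (∑ i, (g i / ∑ j, g j) ^ 2) ∂π
      ≤ ∫⁻ g, ENNReal.ofReal (4 / b ^ 2 * (∑ i, g i ^ 2 + (∑ i, g i - b) ^ 2)) ∂π := by
        refine lintegral_mono_ae ?_
        filter_upwards [hpos] with g hg
        exact ENNReal.ofReal_le_ofReal (sum_sq_div_sum_le (fun i => (hg i).le) hb)
    _ = ENNReal.ofReal (4 / b ^ 2 * (b * (b / N + 1) + b)) := by
        rw [← ofReal_integral_eq_lintegral_ofReal (hint.const_mul _)
          (Eventually.of_forall fun g => by positivity), integral_const_mul,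
          integral_add hint1 hint2, hsq, hvar]
    -- The term 4/N is from the squared means of the gammas; 8/b collects the sum of their variances
    -- and the variance of their sum, both equal to b.
    _ = ENNReal.ofReal (4 / N + 8 / b) := by
        congr 1
        field_simp
        ring

end Dirichlet

/-! ### The approximate posterior -/

section Posterior

variable {X : Type*} [MeasurableSpace X] {a : ℝ} {H : Measure X} [IsProbabilityMeasure H] {n N : ℕ}

theorem isProbabilityMeasure_posteriorBase (ha : 0 < a) (hn : 0 < n) (x : Fin n → X) :
    IsProbabilityMeasure (posteriorBase a H x) := by
  have := isProbabilityMeasure_empirical hn x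
  exact isProbabilityMeasure_smul_add_smul (by positivity) (by positivity) (by field_simp) _ _

theorem isMarkovKernel_atomKernel (ha : 0 < a) (hn : 0 < n) :
    IsMarkovKernel (atomKernel a H n N) where
  isProbabilityMeasure d := by
    have := isProbabilityMeasure_posteriorBase (H := H) ha hn fun i => (d i).2
    change IsProbabilityMeasure (Measure.pi fun _ => _)
    infer_instance

theorem sq_add_le_two_mul (x y : ℝ) : (x + y) ^ 2 ≤ 2 * x ^ 2 + 2 * y ^ 2 := by
  nlinarith [sq_nonneg (x - y)]

/-- Convexity of the square: the prior `H` enters with weight a/(a+n) ≤ a/n and error at most 2B,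
the empirical measure with weight at most 1. -/
theorem sq_integral_posteriorBase_sub_le (ha : 0 < a) (hn : 0 < n) (x : Fin n → X) {f : X → ℝ}
    {B m : ℝ} (hf : Measurable f) (hB : ∀ x, |f x| ≤ B) (hm : |m| ≤ B) :
    (∫ y, f y ∂(posteriorBase a H x) - m) ^ 2 ≤
      4 * B ^ 2 * (a / n) + (∫ y, f y ∂(empirical x) - m) ^ 2 := by
  have := isProbabilityMeasure_empirical hn x
  rw [posteriorBase, integral_smul_add_smul (by positivity) (by positivity)
    (integrable_of_measurable_of_abs_le hf hB) (integrable_of_measurable_of_abs_le hf hB)]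
  set h := ∫ y, f y ∂H
  set e := ∫ y, f y ∂(empirical x)
  have hn' : (0 : ℝ) < n := by positivity
  set r : ℝ := a / (a + n) with hr
  have hr0 : 0 ≤ r := by positivity
  have hs : (n : ℝ) / (a + n) = 1 - r := by rw [hr]; field_simp; ring
  have hs0 : 0 ≤ 1 - r := by rw [← hs]; positivity
  have hrn : r ≤ a / n := div_le_div_of_nonneg_left ha.le hn' (by linarith)
  have hh : |h| ≤ B := abs_integral_le hB
  have hhm : (h - m) ^ 2 ≤ 4 * B ^ 2 := by
    have h1 : |h - m| ≤ 2 * B := (abs_sub _ _).trans (by linarith)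
    have h2 := pow_le_pow_left₀ (abs_nonneg _) h1 2
    rw [sq_abs] at h2
    linarith
  rw [hs]
  calc (r * h + (1 - r) * e - m) ^ 2
      = r * (h - m) ^ 2 + (1 - r) * (e - m) ^ 2 - r * (1 - r) * (h - e) ^ 2 := by ring
    _ ≤ r * (h - m) ^ 2 + (1 - r) * (e - m) ^ 2 := by
        have : 0 ≤ r * (1 - r) * (h - e) ^ 2 := by positivity
        linarith
    _ ≤ a / n * (4 * B ^ 2) + 1 * (e - m) ^ 2 := by
        gcongr
        linarith
    _ = _ := by ring

/-- With data and weights fixed, the error splits into the fluctuation of the atoms around the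
`H*`-mean and the bias of that mean. Centring at it requires the weights to sum to 1. -/
theorem lintegral_sq_sum_mul_atomKernel_le (ha : 0 < a) (hn : 0 < n) (d : Fin n → Bool × X)
    {f : X → ℝ} {B m : ℝ} (hf : Measurable f) (hB : ∀ x, |f x| ≤ B) (hm : |m| ≤ B) {J : Fin N → ℝ}
    (hJ : ∑ i, J i = 1) :
    ∫⁻ y, ENNReal.ofReal ((∑ i, J i * f (y i) - m) ^ 2) ∂(atomKernel a H n N d) ≤
      ENNReal.ofReal (2 * B ^ 2 * ∑ i, J i ^ 2 + 8 * B ^ 2 * (a / n)) +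
        2 * ENNReal.ofReal ((∫ y, f y ∂(empirical fun i => (d i).2) - m) ^ 2) := by
  have hP := isProbabilityMeasure_posteriorBase (H := H) ha hn fun i => (d i).2
  set κ := posteriorBase a H fun i => (d i).2 with hκ
  set h := ∫ y, f y ∂κ
  set e := ∫ y, f y ∂(empirical fun i => (d i).2)
  have key := lintegral_sq_sum_mul_sub_le κ hf hB J
  rw [hJ, one_mul] at key
  have hhm : (h - m) ^ 2 ≤ 4 * B ^ 2 * (a / n) + (e - m) ^ 2 :=
    sq_integral_posteriorBase_sub_le ha hn _ hf hB hm
  have hJ2 : 0 ≤ ∑ i, J i ^ 2 := Finset.sum_nonneg fun i _ => sq_nonneg _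
  calc ∫⁻ y, ENNReal.ofReal ((∑ i, J i * f (y i) - m) ^ 2) ∂(Measure.pi fun _ : Fin N => κ)
      ≤ ∫⁻ y, (2 * ENNReal.ofReal ((∑ i, J i * f (y i) - h) ^ 2) +
          ENNReal.ofReal (2 * (h - m) ^ 2)) ∂(Measure.pi fun _ : Fin N => κ) := by
        refine lintegral_mono fun y => ?_
        rw [← ENNReal.ofReal_ofNat 2, ← ENNReal.ofReal_mul (by norm_num),
          ← ENNReal.ofReal_add (by positivity) (by positivity)]
        refine ENNReal.ofReal_le_ofReal ?_
        have := sq_add_le_two_mul (∑ i, J i * f (y i) - h) (h - m)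
        rwa [sub_add_sub_cancel] at this
    _ = 2 * ∫⁻ y, ENNReal.ofReal ((∑ i, J i * f (y i) - h) ^ 2) ∂(Measure.pi fun _ : Fin N => κ) +
          ENNReal.ofReal (2 * (h - m) ^ 2) := by
        rw [lintegral_add_right _ measurable_const, lintegral_const_mul _ (by fun_prop)]
        simp
    _ ≤ 2 * ENNReal.ofReal (B ^ 2 * ∑ i, J i ^ 2) +
          ENNReal.ofReal (2 * (4 * B ^ 2 * (a / n) + (e - m) ^ 2)) := by gcongr
    _ = _ := by
        rw [← ENNReal.ofReal_ofNat 2, ← ENNReal.ofReal_mul (by norm_num),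
          ← ENNReal.ofReal_mul (by norm_num), ← ENNReal.ofReal_add (by positivity) (by positivity),
          ← ENNReal.ofReal_add (by positivity) (by positivity)]
        ring_nf

variable {𝓩 : Type*} [MeasurableSpace 𝓩] {ε : ℝ} {F₀ Q : Measure X} [IsProbabilityMeasure F₀]
  [IsProbabilityMeasure Q] {FZ : Measure 𝓩} [IsProbabilityMeasure FZ]

theorem lintegral_sq_compProd_atomKernel_le (ha : 0 < a) (h0 : 0 ≤ ε) (h1 : ε ≤ 1) (hn : 0 < n)
    {f : X → ℝ} {B : ℝ} (hf : Measurable f) (hB : ∀ x, |f x| ≤ B) {J : Fin N → ℝ}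
    (hJ : ∑ i, J i = 1) :
    ∫⁻ q, ENNReal.ofReal ((∑ i, J i * f (q.2 i) - ∫ x, f x ∂(huberMixture ε F₀ Q)) ^ 2)
      ∂((Measure.pi fun _ : Fin n => huberPair ε F₀ Q) ⊗ₘ atomKernel a H n N) ≤
      ENNReal.ofReal (2 * B ^ 2 * ∑ i, J i ^ 2 + B ^ 2 * (8 * a + 2) / n) := by
  have := isProbabilityMeasure_huberMixture h0 h1 F₀ Q
  have := isProbabilityMeasure_huberPair h0 h1 F₀ Q
  have := isMarkovKernel_atomKernel (H := H) (N := N) ha hn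
  set m := ∫ x, f x ∂(huberMixture ε F₀ Q) with hm
  have hm' : m = ∫ d, f d.2 ∂(huberPair ε F₀ Q) := by
    rw [hm, ← map_snd_huberPair, integral_map measurable_snd.aemeasurable hf.aestronglyMeasurable]
  have hJ2 : 0 ≤ ∑ i, J i ^ 2 := Finset.sum_nonneg fun i _ => sq_nonneg _
  rw [Measure.lintegral_compProd (by fun_prop)]
  calc ∫⁻ d, ∫⁻ y, ENNReal.ofReal ((∑ i, J i * f (y i) - m) ^ 2) ∂(atomKernel a H n N d)
        ∂(Measure.pi fun _ : Fin n => huberPair ε F₀ Q)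
      ≤ ∫⁻ d, (ENNReal.ofReal (2 * B ^ 2 * ∑ i, J i ^ 2 + 8 * B ^ 2 * (a / n)) +
          2 * ENNReal.ofReal ((∫ q, f q.2 ∂(empirical d) - m) ^ 2))
          ∂(Measure.pi fun _ : Fin n => huberPair ε F₀ Q) := by
        refine lintegral_mono fun d => ?_
        have h := lintegral_sq_sum_mul_atomKernel_le (H := H) ha hn d hf hB (m := m)
          (abs_integral_le hB) hJ
        -- The average of `f` over the observations is rewritten as an average over the pairs, since
        -- it is the pairs that are i.i.d. under the product measure.
        rw [integral_empirical _ hf] at h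
        rwa [integral_empirical (f := fun q : Bool × X => f q.2) _ (hf.comp measurable_snd)]
    _ = ENNReal.ofReal (2 * B ^ 2 * ∑ i, J i ^ 2 + 8 * B ^ 2 * (a / n)) +
          2 * ∫⁻ d, ENNReal.ofReal ((∫ q, f q.2 ∂(empirical d) - m) ^ 2)
          ∂(Measure.pi fun _ : Fin n => huberPair ε F₀ Q) := by
        rw [lintegral_add_left measurable_const, lintegral_const_mul']
        · simp
        · simp
    _ ≤ ENNReal.ofReal (2 * B ^ 2 * ∑ i, J i ^ 2 + 8 * B ^ 2 * (a / n)) +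
          2 * ENNReal.ofReal (B ^ 2 / n) := by
        gcongr
        rw [hm']
        exact lintegral_sq_empirical_sub_le (huberPair ε F₀ Q) (hf.comp measurable_snd)
          (fun q => hB q.2) hn
    _ = _ := by
        rw [← ENNReal.ofReal_ofNat 2, ← ENNReal.ofReal_mul (by norm_num),
          ← ENNReal.ofReal_add (by positivity) (by positivity)]
        ring_nf

/-- The mean squared error of the approximate posterior, tested against a bounded function. -/
theorem lintegral_sq_sampleLaw_le (ha : 0 < a) (h0 : 0 ≤ ε) (h1 : ε ≤ 1) (hn : 0 < n) (hN : 0 < N)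
    {f : X → ℝ} {B : ℝ} (hf : Measurable f) (hB : ∀ x, |f x| ≤ B) :
    ∫⁻ q, ENNReal.ofReal ((∑ i, q.2.1 i * f (q.1.2 i) - ∫ x, f x ∂(huberMixture ε F₀ Q)) ^ 2)
      ∂(sampleLaw ε F₀ Q a H FZ n N) ≤
      ENNReal.ofReal (B ^ 2 * (8 * a + 18) * ((n : ℝ)⁻¹ + (N : ℝ)⁻¹)) := by
  have := isProbabilityMeasure_huberPair h0 h1 F₀ Q
  have := isMarkovKernel_atomKernel (H := H) (N := N) ha hn
  have hα : 0 < (a + n) / (N : ℝ) := by positivity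
  have := isProbabilityMeasure_dirichletMeasure fun _ : Fin N => hα
  have hsimp := ae_dirichletMeasure hN fun _ : Fin N => hα
  have hn' : (0 : ℝ) < n := by positivity
  set D := dirichletMeasure fun _ : Fin N => (a + n) / (N : ℝ) with hD
  -- The weights are independent of data and atoms, so they can be frozen first and integrated last.
  rw [sampleLaw, lintegral_prod_symm' _ (by fun_prop), lintegral_prod _ (by fun_prop)]
  calc ∫⁻ J, ∫⁻ _, ∫⁻ q,
        ENNReal.ofReal ((∑ i, J i * f (q.2 i) - ∫ x, f x ∂(huberMixture ε F₀ Q)) ^ 2)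
        ∂((Measure.pi fun _ : Fin n => huberPair ε F₀ Q) ⊗ₘ atomKernel a H n N)
        ∂(Measure.pi fun _ : Fin N => FZ) ∂D
      ≤ ∫⁻ J, ENNReal.ofReal (2 * B ^ 2 * ∑ i, J i ^ 2 + B ^ 2 * (8 * a + 2) / n) ∂D := by
        refine lintegral_mono_ae ?_
        filter_upwards [hsimp] with J hJ
        rw [lintegral_const, measure_univ, mul_one]
        exact lintegral_sq_compProd_atomKernel_le ha h0 h1 hn hf hB hJ.2
    _ = ENNReal.ofReal (2 * B ^ 2) * ∫⁻ J, ENNReal.ofReal (∑ i, J i ^ 2) ∂D +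
          ENNReal.ofReal (B ^ 2 * (8 * a + 2) / n) := by
        rw [← lintegral_const_mul _ (by fun_prop)]
        simp_rw [← ENNReal.ofReal_mul (show 0 ≤ 2 * B ^ 2 by positivity)]
        have : ∀ J : Fin N → ℝ,
            ENNReal.ofReal (2 * B ^ 2 * ∑ i, J i ^ 2 + B ^ 2 * (8 * a + 2) / n) =
            ENNReal.ofReal (2 * B ^ 2 * ∑ i, J i ^ 2) +
              ENNReal.ofReal (B ^ 2 * (8 * a + 2) / n) := fun J =>
          ENNReal.ofReal_add (by positivity) (by positivity)
        simp_rw [this]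
        rw [lintegral_add_right _ measurable_const, lintegral_const, measure_univ, mul_one]
    _ ≤ ENNReal.ofReal (2 * B ^ 2) * ENNReal.ofReal (4 / N + 8 / (a + n)) +
          ENNReal.ofReal (B ^ 2 * (8 * a + 2) / n) := by
        gcongr
        exact lintegral_sum_sq_dirichletMeasure_le hN (by positivity)
    _ ≤ _ := by
        rw [← ENNReal.ofReal_mul (by positivity),
          ← ENNReal.ofReal_add (by positivity) (by positivity)]
        refine ENNReal.ofReal_le_ofReal ?_
        have h2 : 8 / (a + n) ≤ 8 * (n : ℝ)⁻¹ := by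
          rw [← div_eq_mul_inv]
          exact div_le_div_of_nonneg_left (by norm_num) hn' (by linarith)
        calc 2 * B ^ 2 * (4 / N + 8 / (a + n)) + B ^ 2 * (8 * a + 2) / n
            ≤ 2 * B ^ 2 * (4 / N + 8 * (n : ℝ)⁻¹) + B ^ 2 * (8 * a + 2) / n := by gcongr
          -- 18 = 16 + 2: the Dirichlet weights contribute 16, the sampling of the data 2; 8a is due
          -- to the prior.
          _ = B ^ 2 * (8 * a + 18) * (n : ℝ)⁻¹ + B ^ 2 * 8 * (N : ℝ)⁻¹ := by ring
          _ ≤ B ^ 2 * (8 * a + 18) * (n : ℝ)⁻¹ + B ^ 2 * (8 * a + 18) * (N : ℝ)⁻¹ := by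
              gcongr
              linarith
          _ = _ := by ring

theorem hasLaw_latent (ha : 0 < a) (h0 : 0 ≤ ε) (h1 : ε ≤ 1) (hn : 0 < n) (hN : 0 < N) :
    HasLaw (fun q => q.2.2) (Measure.pi fun _ : Fin N => FZ) (sampleLaw ε F₀ Q a H FZ n N) := by
  have := isProbabilityMeasure_huberPair h0 h1 F₀ Q
  have := isMarkovKernel_atomKernel (H := H) (N := N) ha hn
  have hα : 0 < (a + n) / (N : ℝ) := by positivity
  have := isProbabilityMeasure_dirichletMeasure fun _ : Fin N => hα
  exact (measurePreserving_snd.comp measurePreserving_snd).hasLaw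

theorem hasLaw_weights (ha : 0 < a) (h0 : 0 ≤ ε) (h1 : ε ≤ 1) (hn : 0 < n) (hN : 0 < N) :
    HasLaw (fun q => q.2.1) (dirichletMeasure fun _ : Fin N => (a + n) / (N : ℝ))
      (sampleLaw ε F₀ Q a H FZ n N) := by
  have := isProbabilityMeasure_huberPair h0 h1 F₀ Q
  have := isMarkovKernel_atomKernel (H := H) (N := N) ha hn
  have hα : 0 < (a + n) / (N : ℝ) := by positivity
  have := isProbabilityMeasure_dirichletMeasure fun _ : Fin N => hα
  exact (measurePreserving_fst.comp measurePreserving_snd).hasLaw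

end Posterior

theorem integrable_and_integral_le_of_hasLaw {S Y : Type*} [MeasurableSpace S] [MeasurableSpace Y]
    {P : Measure S} {κ : Measure Y} {T : S → Y} (hT : HasLaw T κ P) {f : Y → ℝ} (hf : Measurable f)
    (h0 : ∀ y, 0 ≤ f y) {r : ℝ} (hr : 0 ≤ r)
    (h : ∫⁻ y, ENNReal.ofReal (f y) ∂κ ≤ ENNReal.ofReal r) :
    Integrable (fun s => f (T s)) P ∧ ∫ s, f (T s) ∂P ≤ r := by
  have hm : AEStronglyMeasurable (fun s => f (T s)) P :=
    (hf.comp_aemeasurable hT.aemeasurable).aestronglyMeasurable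
  have hle : ∫⁻ s, ENNReal.ofReal (f (T s)) ∂P ≤ ENNReal.ofReal r := by
    rw [hT.lintegral_comp (f := fun y => ENNReal.ofReal (f y)) hf.ennreal_ofReal.aemeasurable]
    exact h
  refine ⟨⟨hm, ?_⟩, ?_⟩
  · rw [hasFiniteIntegral_iff_ofReal (Eventually.of_forall fun s => h0 _)]
    exact hle.trans_lt ENNReal.ofReal_lt_top
  · rw [integral_eq_lintegral_of_nonneg_ae (Eventually.of_forall fun s => h0 _) hm]
    exact ENNReal.toReal_le_of_le_ofReal hr hle

theorem measurable_gen {Ω 𝓩 X : Type*} [TopologicalSpace Ω] [TopologicalSpace 𝓩]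
    [MeasurableSpace 𝓩] [OpensMeasurableSpace 𝓩] [TopologicalSpace X] [MeasurableSpace X]
    [BorelSpace X] {Gen : Ω → 𝓩 → X} (hGen : Continuous (Function.uncurry Gen)) (ω : Ω) :
    Measurable (Gen ω) :=
  (hGen.comp (by fun_prop : Continuous fun z => (ω, z))).measurable

/-! ### Uniform control over the generator parameters -/

section Generator

variable {Ω 𝓩 : Type*} [TopologicalSpace Ω] [CompactSpace Ω] [TopologicalSpace 𝓩] [T2Space 𝓩]
  [MeasurableSpace 𝓩] [OpensMeasurableSpace 𝓩]

/-- A bounded continuous function with a compact parameter is, up to a small error, controlled in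
mean by finitely many test functions, uniformly in the parameter. -/
theorem exists_finset_abs_integral_sub_le {u : Ω → 𝓩 → ℝ} (hu : Continuous (Function.uncurry u))
    {B : ℝ} (hB0 : 0 ≤ B) (hB : ∀ ω z, |u ω z| ≤ B) (κ : Measure 𝓩) [IsProbabilityMeasure κ]
    [κ.InnerRegular] {δ : ℝ} (hδ : 0 < δ) :
    ∃ Φ : Finset (𝓩 → ℝ), (∀ φ ∈ Φ, Measurable φ ∧ ∃ C, ∀ z, |φ z| ≤ C) ∧
      ∀ (ν : Measure 𝓩) [IsProbabilityMeasure ν] (ω : Ω),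
        |∫ z, u ω z ∂ν - ∫ z, u ω z ∂κ| ≤ δ + 2 * ∑ φ ∈ Φ, |∫ z, φ z ∂ν - ∫ z, φ z ∂κ| := by
  classical
  -- Off the compact set two members of the family differ by at most 2B, so this mass costs at most
  -- δ/4; `B + 1` covers B = 0.
  have hη : 0 < δ / (8 * (B + 1)) := by positivity
  obtain ⟨C, hC, hCκ⟩ := isTightMeasureSet_iff_exists_isCompact_measure_compl_le.1
    (isTightMeasureSet_singleton_of_innerRegular (μ := κ)) _ (ENNReal.ofReal_pos.2 hη)
  have hCκ : κ.real Cᶜ ≤ δ / (8 * (B + 1)) :=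
    ENNReal.toReal_le_of_le_ofReal hη.le (hCκ κ rfl)
  have hCm : MeasurableSet Cᶜ := hC.measurableSet.compl
  have : CompactSpace C := isCompact_iff_compactSpace.1 hC
  have hum : ∀ ω, Measurable (u ω) := fun ω =>
    (hu.comp (by fun_prop : Continuous fun z => (ω, z))).measurable
  -- Over the compact `C`, currying makes the family continuous in ω for the uniform norm, so its
  -- range is compact and has a finite net.
  let T : C(Ω, C(C, ℝ)) := ContinuousMap.curry
    ⟨fun q : Ω × C => u q.1 q.2,
      hu.comp (by fun_prop : Continuous fun q : Ω × C => (q.1, (q.2 : 𝓩)))⟩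
  obtain ⟨t, htT, ht, htcover⟩ := Metric.finite_approx_of_totallyBounded
    (isCompact_range T.continuous).totallyBounded (δ / 4) (by positivity)
  choose w hw using fun f : t => htT f.2
  have : Finite t := ht
  have := Fintype.ofFinite t
  -- Only κ is known to be nearly carried by `C`. Taking `χ` as a test function transfers this to ν
  -- at the price of one more error term.
  set χ : 𝓩 → ℝ := Cᶜ.indicator fun _ => 2 * B with hχ
  have hχm : Measurable χ := measurable_const.indicator hCm
  have hχ0 : ∀ z, 0 ≤ χ z := fun z => Set.indicator_nonneg (fun _ _ => by positivity) z
  have hχB : ∀ z, |χ z| ≤ 2 * B := fun z => by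
    rw [abs_of_nonneg (hχ0 z)]
    exact Set.indicator_le_self' (fun _ _ => by positivity) z
  refine ⟨insert χ (Finset.univ.image fun f => u (w f)), ?_, fun ν _ ω => ?_⟩
  · intro φ hφ
    rcases Finset.mem_insert.1 hφ with rfl | hφ
    · exact ⟨hχm, _, hχB⟩
    · obtain ⟨f, -, rfl⟩ := Finset.mem_image.1 hφ
      exact ⟨hum _, B, hB _⟩
  obtain ⟨f, hft, hf⟩ := Set.mem_iUnion₂.1 (htcover ⟨ω, rfl⟩)
  set ω' := w ⟨f, hft⟩ with hω'
  have hTω' : T ω' = f := hw ⟨f, hft⟩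
  have hclose : ∀ z, |u ω z - u ω' z| ≤ δ / 4 + χ z := by
    intro z
    by_cases hz : z ∈ C
    · rw [hχ, Set.indicator_of_notMem (by simpa using hz), add_zero]
      rw [← hTω'] at hf
      exact (ContinuousMap.dist_apply_le_dist (⟨z, hz⟩ : C)).trans (Metric.mem_ball.1 hf).le
    · rw [hχ, Set.indicator_of_mem (by simpa using hz)]
      have := abs_sub (u ω z) (u ω' z)
      linarith [hB ω z, hB ω' z]
  have hint : ∀ (η : Measure 𝓩) [IsProbabilityMeasure η],
      |∫ z, u ω z ∂η - ∫ z, u ω' z ∂η| ≤ δ / 4 + ∫ z, χ z ∂η := by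
    intro η _
    have hi1 : Integrable (u ω) η := integrable_of_measurable_of_abs_le (hum ω) (hB ω)
    have hi2 : Integrable (u ω') η := integrable_of_measurable_of_abs_le (hum ω') (hB ω')
    have hi3 : Integrable χ η := integrable_of_measurable_of_abs_le hχm hχB
    rw [← integral_sub hi1 hi2]
    calc |∫ z, (u ω z - u ω' z) ∂η| ≤ ∫ z, |u ω z - u ω' z| ∂η := abs_integral_le_integral_abs
      _ ≤ ∫ z, (δ / 4 + χ z) ∂η :=
          integral_mono (hi1.sub hi2).abs ((integrable_const _).add hi3) hclose
      _ = _ := by rw [integral_add (integrable_const _) hi3]; simp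
  have hχκ : ∫ z, χ z ∂κ ≤ δ / 4 := by
    rw [hχ, integral_indicator_const _ hCm, smul_eq_mul]
    calc κ.real Cᶜ * (2 * B) ≤ δ / (8 * (B + 1)) * (2 * (B + 1)) := by gcongr; linarith
      _ = δ / 4 := by field_simp; ring
  have h1 := hint ν
  have h2 := hint κ
  have hmem1 : χ ∈ insert χ (Finset.univ.image fun f => u (w f)) := Finset.mem_insert_self _ _
  have hmem2 : u ω' ∈ insert χ (Finset.univ.image fun f => u (w f)) :=
    Finset.mem_insert_of_mem (Finset.mem_image_of_mem (fun f => u (w f)) (Finset.mem_univ _))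
  have h3 := Finset.single_le_sum (f := fun φ : 𝓩 → ℝ => |∫ z, φ z ∂ν - ∫ z, φ z ∂κ|)
    (fun _ _ => abs_nonneg _) hmem1
  have h4 := Finset.single_le_sum (f := fun φ : 𝓩 → ℝ => |∫ z, φ z ∂ν - ∫ z, φ z ∂κ|)
    (fun _ _ => abs_nonneg _) hmem2
  have h5 := abs_le.1 h1
  have h6 := abs_le.1 h2
  have h7 := le_abs_self (∫ z, χ z ∂ν - ∫ z, χ z ∂κ)
  have h8 := abs_le.1 (le_refl |∫ z, u ω' z ∂ν - ∫ z, u ω' z ∂κ|)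
  -- Two net errors and the integrals of `χ` under ν and κ give four times δ/4; the test errors of
  -- `χ` and `u ω'` give the factor 2.
  rw [abs_le]
  constructor <;> linarith [h5.1, h5.2, h6.1, h6.2, h8.1, h8.2]

variable {X : Type*} [MetricSpace X] [CompactSpace X] [MeasurableSpace X] [BorelSpace X]
  {Gen : Ω → 𝓩 → X}

/-- Each of the finitely many test functions on `X`, composed with the generator, is a bounded
family in ω to which the uniform net applies. The bound does not involve ω, so it also holds at a
parameter chosen from the latent sample. -/
theorem exists_wmmd_genLaw_le {𝓗 : Type*} [NormedAddCommGroup 𝓗] [InnerProductSpace ℝ 𝓗]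
    [CompleteSpace 𝓗] [RKHS ℝ 𝓗 X ℝ] {K : ℝ}
    (hk : Continuous fun p : X × X => kernelFn 𝓗 p.1 p.2)
    (hK : ∀ x y : X, |kernelFn 𝓗 x y| < K) (hGen : Continuous (Function.uncurry Gen))
    (κ : Measure 𝓩) [IsProbabilityMeasure κ] [κ.InnerRegular] {δ : ℝ} (hδ : 0 < δ) :
    ∃ (Φ : Finset (𝓩 → ℝ)) (M : ℝ), 0 ≤ M ∧ (∀ φ ∈ Φ, Measurable φ ∧ ∃ C, ∀ z, |φ z| ≤ C) ∧
      ∀ (ν : Measure 𝓩) [IsProbabilityMeasure ν] (ω : Ω),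
        wmmd 𝓗 (genLaw Gen ν ω) (genLaw Gen κ ω) ≤
          δ + M * ∑ φ ∈ Φ, (∫ z, φ z ∂ν - ∫ z, φ z ∂κ) ^ 2 ∧
        wmmd 𝓗 (genLaw Gen κ ω) (genLaw Gen ν ω) ≤
          δ + M * ∑ φ ∈ Φ, (∫ z, φ z ∂ν - ∫ z, φ z ∂κ) ^ 2 := by
  classical
  obtain ⟨G, hG⟩ := exists_wmmd_le_sum_abs hk hK (by positivity : 0 < δ / 2)
  have hη : 0 < δ / (8 * (G.card + 1)) := by positivity
  choose Φ hΦ hΦle using fun g : C(X, ℝ) => exists_finset_abs_integral_sub_le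
    (u := fun ω z => g (Gen ω z)) (g.continuous.comp hGen) (norm_nonneg g)
    (fun ω z => g.norm_coe_le_norm _) κ hη
  obtain ⟨M, hM, hΦM⟩ := exists_sum_abs_le_add_sum_sq (G.biUnion Φ)
    (by positivity : 0 < δ / (16 * (G.card + 1)))
  refine ⟨G.biUnion Φ, 4 * G.card * M, by positivity, fun φ hφ => ?_, fun ν _ ω => ?_⟩
  · obtain ⟨g, -, hg⟩ := Finset.mem_biUnion.1 hφ
    exact hΦ g φ hg
  have hm := measurable_gen hGen ω
  have hP : ∀ (η : Measure 𝓩) [IsProbabilityMeasure η], IsProbabilityMeasure (genLaw Gen η ω) :=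
    fun η _ => Measure.isProbabilityMeasure_map hm.aemeasurable
  have := hP ν
  have := hP κ
  have hint : ∀ (η : Measure 𝓩) (g : C(X, ℝ)),
      ∫ x, g x ∂(genLaw Gen η ω) = ∫ z, g (Gen ω z) ∂η := fun η g =>
    integral_map hm.aemeasurable g.continuous.measurable.aestronglyMeasurable
  have key : ∑ g ∈ G, |∫ x, g x ∂(genLaw Gen ν ω) - ∫ x, g x ∂(genLaw Gen κ ω)| ≤
      δ / 4 + 2 * G.card * M * ∑ φ ∈ G.biUnion Φ, (∫ z, φ z ∂ν - ∫ z, φ z ∂κ) ^ 2 := by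
    have hΦM' := hΦM fun φ => ∫ z, φ z ∂ν - ∫ z, φ z ∂κ
    calc ∑ g ∈ G, |∫ x, g x ∂(genLaw Gen ν ω) - ∫ x, g x ∂(genLaw Gen κ ω)|
        ≤ ∑ _g ∈ G, (δ / (8 * (G.card + 1)) + 2 * (δ / (16 * (G.card + 1)) +
            M * ∑ φ ∈ G.biUnion Φ, (∫ z, φ z ∂ν - ∫ z, φ z ∂κ) ^ 2)) := by
          refine Finset.sum_le_sum fun g hg => ?_
          rw [hint, hint]
          refine (hΦle g ν ω).trans ?_
          gcongr
          refine le_trans ?_ hΦM'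
          exact Finset.sum_le_sum_of_subset_of_nonneg (Finset.subset_biUnion_of_mem Φ hg)
            fun _ _ _ => abs_nonneg _
      _ = δ / 4 * (G.card / (G.card + 1)) +
            2 * G.card * M * ∑ φ ∈ G.biUnion Φ, (∫ z, φ z ∂ν - ∫ z, φ z ∂κ) ^ 2 := by
          rw [Finset.sum_const, nsmul_eq_mul]
          field_simp
          ring
      _ ≤ δ / 4 * 1 + 2 * G.card * M * ∑ φ ∈ G.biUnion Φ, (∫ z, φ z ∂ν - ∫ z, φ z ∂κ) ^ 2 := by
          gcongr
          rw [div_le_one (by positivity)]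
          linarith
      _ = _ := by ring
  constructor
  · linarith [hG (genLaw Gen ν ω) (genLaw Gen κ ω)]
  · have h1 := hG (genLaw Gen κ ω) (genLaw Gen ν ω)
    simp_rw [abs_sub_comm (∫ x, _ ∂(genLaw Gen κ ω))] at h1
    linarith

end Generator

/-! ### The simulated generator, integrability of the risk, and the comparison at a minimizer -/

/-- Lets the simulated generator be treated as the same generator driven by the empirical latent
law. -/
theorem empirical_comp {Y W : Type*} [MeasurableSpace Y] [MeasurableSpace W] {T : Y → W}
    (hT : Measurable T) {N : ℕ} (z : Fin N → Y) :
    empirical (fun i => T (z i)) = (empirical z).map T := by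
  rw [empirical, empirical, Measure.map_smul, Measure.map_finset_sum hT.aemeasurable]
  simp [Measure.map_dirac' hT]

theorem isProbabilityMeasure_genLaw {Ω 𝓩 X : Type*} [TopologicalSpace Ω] [TopologicalSpace 𝓩]
    [MeasurableSpace 𝓩] [OpensMeasurableSpace 𝓩] [TopologicalSpace X] [MeasurableSpace X]
    [BorelSpace X] {Gen : Ω → 𝓩 → X} (hGen : Continuous (Function.uncurry Gen)) (κ : Measure 𝓩)
    [IsProbabilityMeasure κ] (ω : Ω) : IsProbabilityMeasure (genLaw Gen κ ω) :=
  Measure.isProbabilityMeasure_map (measurable_gen hGen ω).aemeasurable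

section Risk

variable {X : Type*} [MetricSpace X] [CompactSpace X] [MeasurableSpace X] [BorelSpace X]
  {𝓗 : Type*} [NormedAddCommGroup 𝓗] [InnerProductSpace ℝ 𝓗] [CompleteSpace 𝓗] [RKHS ℝ 𝓗 X ℝ]
  {K : ℝ} {Ω 𝓩 : Type*} [TopologicalSpace Ω] [FirstCountableTopology Ω] [TopologicalSpace 𝓩]
  [MeasurableSpace 𝓩] [OpensMeasurableSpace 𝓩] {Gen : Ω → 𝓩 → X}

theorem continuous_integral_genLaw (hGen : Continuous (Function.uncurry Gen)) (κ : Measure 𝓩)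
    [IsProbabilityMeasure κ] (g : C(X, ℝ)) : Continuous fun ω => ∫ x, g x ∂(genLaw Gen κ ω) := by
  have h : ∀ ω, ∫ x, g x ∂(genLaw Gen κ ω) = ∫ z, g (Gen ω z) ∂κ := fun ω =>
    integral_map (measurable_gen hGen ω).aemeasurable g.continuous.measurable.aestronglyMeasurable
  simp_rw [h]
  refine continuous_of_dominated (bound := fun _ => ‖g‖) (fun ω => ?_)
    (fun ω => Eventually.of_forall fun z => g.norm_coe_le_norm _) (integrable_const _)
    (Eventually.of_forall fun z => ?_)
  · exact (g.continuous.measurable.comp (measurable_gen hGen ω)).aestronglyMeasurable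
  · exact g.continuous.comp (hGen.comp (by fun_prop : Continuous fun ω => (ω, z)))

theorem integrable_wmmd_genLaw [MeasurableSpace Ω] [OpensMeasurableSpace Ω]
    (hk : Continuous fun p : X × X => kernelFn 𝓗 p.1 p.2)
    (hK : ∀ x y : X, |kernelFn 𝓗 x y| < K) (hGen : Continuous (Function.uncurry Gen))
    (κ : Measure 𝓩) [IsProbabilityMeasure κ] (μ : Measure X) [IsProbabilityMeasure μ]
    {S : Type*} [MeasurableSpace S] {P : Measure S} [IsFiniteMeasure P] {w : S → Ω}
    (hw : AEMeasurable w P) : Integrable (fun s => wmmd 𝓗 μ (genLaw Gen κ (w s))) P := by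
  have := isProbabilityMeasure_genLaw hGen κ
  obtain ⟨B, hB⟩ := exists_wmmd_le (X := X) hk hK
  have hm := measurable_wmmd hk hK μ (continuous_integral_genLaw hGen κ)
  refine Integrable.of_bound (hm.comp_aemeasurable hw).aestronglyMeasurable B
    (Eventually.of_forall fun s => ?_)
  rw [Real.norm_of_nonneg (wmmd_nonneg hk hK _ _)]
  exact hB _ _

end Risk

/-- The deterministic part of the argument: the distance of the fitted model to the true model is
bounded by the errors of the approximate posterior and of the simulated generator. -/
theorem wmmd_genLaw_le_of_isMinimizer {X : Type*} [MetricSpace X] [CompactSpace X]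
    [MeasurableSpace X] [BorelSpace X] {𝓗 : Type*} [NormedAddCommGroup 𝓗] [InnerProductSpace ℝ 𝓗]
    [CompleteSpace 𝓗] [RKHS ℝ 𝓗 X ℝ] {K : ℝ} {Ω 𝓩 : Type*} [TopologicalSpace Ω]
    [TopologicalSpace 𝓩] [MeasurableSpace 𝓩] [OpensMeasurableSpace 𝓩] {Gen : Ω → 𝓩 → X}
    (hk : Continuous fun p : X × X => kernelFn 𝓗 p.1 p.2)
    (hK : ∀ x y : X, |kernelFn 𝓗 x y| < K) (hGen : Continuous (Function.uncurry Gen))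
    (κ : Measure 𝓩) [IsProbabilityMeasure κ] (μ F ν : Measure X) [IsProbabilityMeasure μ]
    [IsProbabilityMeasure F] [IsProbabilityMeasure ν] {ω₀ w : Ω}
    (hω₀ : wmmd 𝓗 F (genLaw Gen κ ω₀) = 0) {N : ℕ} (hN : 0 < N) (z : Fin N → 𝓩) {A₁ A₂ : ℝ}
    (h1 : wmmd 𝓗 F ν ≤ A₁) (h1' : wmmd 𝓗 ν F ≤ A₁)
    (h2 : ∀ ω, wmmd 𝓗 (genLaw Gen (empirical z) ω) (genLaw Gen κ ω) ≤ A₂)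
    (h2' : ∀ ω, wmmd 𝓗 (genLaw Gen κ ω) (genLaw Gen (empirical z) ω) ≤ A₂)
    (hmin : IsMinimizer 𝓗 Gen κ ν w ∨ IsSampleMinimizer 𝓗 Gen z ν w) :
    wmmd 𝓗 μ (genLaw Gen κ w) ≤ wmmd 𝓗 μ F + 2 * A₁ + 2 * A₂ := by
  have := isProbabilityMeasure_empirical hN z
  have := isProbabilityMeasure_genLaw hGen κ
  have := isProbabilityMeasure_genLaw hGen (empirical z)
  have hemp : ∀ ω, (empirical fun i => Gen ω (z i)) = genLaw Gen (empirical z) ω := fun ω =>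
    empirical_comp (measurable_gen hGen ω) z
  -- In the exact-minimizer case no simulation error arises, and nonnegativity lets both cases share
  -- one bound.
  have hA₂ : 0 ≤ A₂ := (wmmd_nonneg hk hK _ _).trans (h2 w)
  have t1 := wmmd_triangle hk hK μ F (genLaw Gen κ w)
  have t2 := wmmd_triangle hk hK F ν (genLaw Gen κ w)
  have t3 := wmmd_triangle hk hK ν F (genLaw Gen κ ω₀)
  rcases hmin with hmin | hmin
  · linarith [hmin ω₀]
  · have hw := hmin ω₀
    rw [hemp, hemp] at hw
    have t4 := wmmd_triangle hk hK ν (genLaw Gen κ ω₀) (genLaw Gen (empirical z) ω₀)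
    have t5 := wmmd_triangle hk hK ν (genLaw Gen (empirical z) w) (genLaw Gen κ w)
    linarith [h2 w, h2' ω₀]

/-! ### The joint limit in n and N -/

theorem tendsto_inv_add_inv :
    Tendsto (fun q : ℕ × ℕ => (q.1 : ℝ)⁻¹ + (q.2 : ℝ)⁻¹) (atTop ×ˢ atTop) (𝓝 0) := by
  have h : Tendsto (fun n : ℕ => (n : ℝ)⁻¹) atTop (𝓝 0) := tendsto_inv_atTop_nhds_zero_nat
  simpa using (h.comp tendsto_fst).add (h.comp tendsto_snd)

/-- Taking the limsup in `EReal` avoids the default values of a real limsup. For fixed δ the rate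
term vanishes, and δ is then arbitrary. -/
theorem limsup_coe_le_of_forall_exists_rate {e : ℕ × ℕ → ℝ} {C : ℝ}
    (h : ∀ δ > 0, ∃ R : ℝ, ∀ n N : ℕ, 0 < n → 0 < N →
      e (n, N) ≤ C + δ + R * ((n : ℝ)⁻¹ + (N : ℝ)⁻¹)) :
    limsup (fun q => (e q : EReal)) (atTop ×ˢ atTop) ≤ (C : EReal) := by
  refine EReal.le_of_forall_lt_iff_le.1 fun C' hC' => ?_
  have hC' : C < C' := EReal.coe_lt_coe_iff.1 hC'
  obtain ⟨R, hR⟩ := h ((C' - C) / 2) (by linarith)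
  have hlim : Tendsto (fun q : ℕ × ℕ => R * ((q.1 : ℝ)⁻¹ + (q.2 : ℝ)⁻¹)) (atTop ×ˢ atTop)
      (𝓝 0) := by
    simpa using tendsto_inv_add_inv.const_mul R
  refine limsup_le_of_le (by isBoundedDefault) ?_
  filter_upwards [hlim.eventually_lt_const (show 0 < (C' - C) / 2 by linarith),
    tendsto_fst.eventually (eventually_gt_atTop 0),
    tendsto_snd.eventually (eventually_gt_atTop 0)] with q hq h1 h2
  exact EReal.coe_le_coe_iff.2 (by linarith [hR q.1 q.2 h1 h2])

end BNPL

/-! ### The contamination bound for the fitted generator -/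

theorem mainTheorem5
    -- the compact metric data space
    {𝔛 : Type*} [MetricSpace 𝔛] [CompactSpace 𝔛] [MeasurableSpace 𝔛] [BorelSpace 𝔛]
    -- the universal RKHS of a continuous kernel that is bounded by `K`
    {𝓗 : Type*} [NormedAddCommGroup 𝓗] [InnerProductSpace ℝ 𝓗] [CompleteSpace 𝓗]
    [RKHS ℝ 𝓗 𝔛 ℝ]
    (hk : Continuous fun p : 𝔛 × 𝔛 => BNPL.kernelFn 𝓗 p.1 p.2)
    (huniv : BNPL.IsUniversal (𝔛 := 𝔛) 𝓗)
    {K : ℝ} (hK : ∀ x y : 𝔛, |BNPL.kernelFn 𝓗 x y| < K)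
    -- Huber's contamination model
    (F₀ Q : Measure 𝔛) [IsProbabilityMeasure F₀] [IsProbabilityMeasure Q]
    {ε : ℝ} (hε : ε ∈ Set.Ioo (0 : ℝ) (1 / 2))
    {c : ℝ} (hc : BNPL.wasserstein F₀ Q = c)
    -- the Dirichlet process prior `DP(a, H)`
    {a : ℝ} (ha : 0 < a) (H : Measure 𝔛) [IsProbabilityMeasure H]
    -- the generator, with latent distribution `FZ` and compact parameter set `Par`
    {p t : ℕ} (FZ : Measure (EuclideanSpace ℝ (Fin p))) [IsProbabilityMeasure FZ]
    (Par : Set (EuclideanSpace ℝ (Fin t))) (hPar : IsCompact Par)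
    (Gen : Par → EuclideanSpace ℝ (Fin p) → 𝔛) (hGen : Continuous (Function.uncurry Gen))
    -- the well-specified case
    (hTrue : ∃ ωTrue : Par,
      BNPL.wmmd 𝓗 (BNPL.huberMixture ε F₀ Q) (BNPL.genLaw Gen FZ ωTrue) = 0)
    -- the random variables: outlier indicators, observations, posterior atoms, weights and
    -- latent variables
    {S : Type*} [MeasurableSpace S] (P : Measure S) [IsProbabilityMeasure P]
    (ζ : ℕ → S → Bool) (X : ℕ → S → 𝔛)
    (Xpos : ∀ n N : ℕ, S → Fin N → 𝔛) (J : ∀ n N : ℕ, S → Fin N → ℝ)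
    (Z : ∀ n N : ℕ, S → Fin N → EuclideanSpace ℝ (Fin p))
    (hlaw : ∀ n N : ℕ, 0 < n → 0 < N →
      HasLaw (fun s => (((fun i : Fin n => (ζ i s, X i s)), Xpos n N s), J n N s, Z n N s))
        (BNPL.sampleLaw ε F₀ Q a H FZ n N) P)
    -- the optimized generator parameter
    (ωstar : ∀ n N : ℕ, S → Par) (hωmeas : ∀ n N : ℕ, AEMeasurable (ωstar n N) P)
    (hωstar :
      (∀ n N : ℕ, 0 < n → 0 < N → ∀ᵐ s ∂P,
        BNPL.IsMinimizer 𝓗 Gen FZ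
          (BNPL.weightedAtoms (J n N s) (Xpos n N s)) (ωstar n N s)) ∨
      (∀ n N : ℕ, 0 < n → 0 < N → ∀ᵐ s ∂P,
        BNPL.IsSampleMinimizer 𝓗 Gen (Z n N s)
          (BNPL.weightedAtoms (J n N s) (Xpos n N s)) (ωstar n N s))) :
    (∀ n N : ℕ,
      Integrable (fun s => BNPL.wmmd 𝓗 F₀ (BNPL.genLaw Gen FZ (ωstar n N s))) P) ∧
    limsup (fun q : ℕ × ℕ =>
        ((∫ s, BNPL.wmmd 𝓗 F₀ (BNPL.genLaw Gen FZ (ωstar q.1 q.2 s)) ∂P : ℝ) : EReal))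
      (atTop ×ˢ atTop) ≤ (((2 * √K + c) * ε : ℝ) : EReal) ∧
    (K ≤ 1 →
      limsup (fun q : ℕ × ℕ =>
          ((∫ s, BNPL.wmmd 𝓗 F₀ (BNPL.genLaw Gen FZ (ωstar q.1 q.2 s)) ∂P : ℝ) : EReal))
        (atTop ×ˢ atTop) ≤ (((2 + c) * ε : ℝ) : EReal)) := by
  have : CompactSpace Par := isCompact_iff_compactSpace.1 hPar
  obtain ⟨ωT, hT⟩ := hTrue
  have hε0 : 0 ≤ ε := hε.1.le
  have hε1 : ε ≤ 1 := by linarith [hε.2]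
  have := BNPL.isProbabilityMeasure_huberMixture hε0 hε1 F₀ Q
  set F := BNPL.huberMixture ε F₀ Q with hF
  have hint : ∀ n N : ℕ,
      Integrable (fun s => BNPL.wmmd 𝓗 F₀ (BNPL.genLaw Gen FZ (ωstar n N s))) P := fun n N =>
    BNPL.integrable_wmmd_genLaw hk hK hGen FZ F₀ (hωmeas n N)
  have hrate : ∀ δ > 0, ∃ R : ℝ, ∀ n N : ℕ, 0 < n → 0 < N →
      ∫ s, BNPL.wmmd 𝓗 F₀ (BNPL.genLaw Gen FZ (ωstar n N s)) ∂P ≤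
        (2 * √K + c) * ε + δ + R * ((n : ℝ)⁻¹ + (N : ℝ)⁻¹) := by
    intro δ hδ
    -- A₁ and A₂ each occur twice in the comparison, so δ/4 in each adds up to δ.
    obtain ⟨G, M₁, hM₁, hG⟩ := BNPL.exists_wmmd_le_sum_sq (X := 𝔛) hk hK
      (show 0 < δ / 4 by positivity)
    obtain ⟨Φ, M₂, hM₂, hΦ, hΦle⟩ := BNPL.exists_wmmd_genLaw_le hk hK hGen FZ
      (show 0 < δ / 4 by positivity)
    choose! B hB using fun φ hφ => (hΦ φ hφ).2
    set r₁ : C(𝔛, ℝ) → ℝ := fun g => ‖g‖ ^ 2 * (8 * a + 18)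
    set r₂ : (EuclideanSpace ℝ (Fin p) → ℝ) → ℝ := fun φ => B φ ^ 2
    refine ⟨2 * M₁ * ∑ g ∈ G, r₁ g + 2 * M₂ * ∑ φ ∈ Φ, r₂ φ, fun n N hn hN => ?_⟩
    have hlaw := hlaw n N hn hN
    set ρ : ℝ := (n : ℝ)⁻¹ + (N : ℝ)⁻¹ with hρ
    set x : C(𝔛, ℝ) → S → ℝ := fun g s =>
      (∑ i, J n N s i * g (Xpos n N s i) - ∫ x, g x ∂F) ^ 2 with hx
    set y : (EuclideanSpace ℝ (Fin p) → ℝ) → S → ℝ := fun φ s =>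
      (∫ z, φ z ∂(BNPL.empirical (Z n N s)) - ∫ z, φ z ∂FZ) ^ 2 with hy
    have hxle : ∀ g, Integrable (x g) P ∧ ∫ s, x g s ∂P ≤ r₁ g * ρ := fun g =>
      have hgm : Measurable g := g.continuous.measurable
      BNPL.integrable_and_integral_le_of_hasLaw hlaw
        (f := fun q => (∑ i, q.2.1 i * g (q.1.2 i) - ∫ x, g x ∂F) ^ 2) (by fun_prop)
        (fun _ => sq_nonneg _) (by positivity)
        (BNPL.lintegral_sq_sampleLaw_le ha hε0 hε1 hn hN hgm g.norm_coe_le_norm)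
    have hyle : ∀ φ ∈ Φ, Integrable (y φ) P ∧ ∫ s, y φ s ∂P ≤ r₂ φ * ρ := fun φ hφ => by
      have hφm := (hΦ φ hφ).1
      have h := BNPL.integrable_and_integral_le_of_hasLaw
        ((BNPL.hasLaw_latent ha hε0 hε1 hn hN).fun_comp hlaw)
        (f := fun z => (∫ u, φ u ∂(BNPL.empirical z) - ∫ u, φ u ∂FZ) ^ 2)
        (by simp_rw [BNPL.integral_empirical _ hφm]; fun_prop)
        (fun _ => sq_nonneg _) (by positivity)
        (BNPL.lintegral_sq_empirical_sub_le FZ hφm (hB φ hφ) hN)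
      -- The latent sample alone gives the rate 1/N, enlarged to ρ for uniformity.
      refine ⟨h.1, h.2.trans ?_⟩
      rw [div_eq_mul_inv]
      exact mul_le_mul_of_nonneg_left (le_add_of_nonneg_left (by positivity)) (sq_nonneg _)
    have hα : 0 < (a + n) / (N : ℝ) := by positivity
    -- Almost surely the weights lie in the simplex, which makes the approximate posterior a
    -- probability measure.
    have hJ : ∀ᵐ s ∂P, (∀ i, 0 ≤ J n N s i) ∧ ∑ i, J n N s i = 1 := by
      have hJlaw := (BNPL.hasLaw_weights ha hε0 hε1 hn hN).fun_comp hlaw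
      have h := BNPL.ae_dirichletMeasure hN fun _ : Fin N => hα
      rw [← hJlaw.map_eq] at h
      exact ae_of_ae_map hJlaw.aemeasurable h
    have hmin : ∀ᵐ s ∂P,
        BNPL.IsMinimizer 𝓗 Gen FZ (BNPL.weightedAtoms (J n N s) (Xpos n N s)) (ωstar n N s) ∨
        BNPL.IsSampleMinimizer 𝓗 Gen (Z n N s) (BNPL.weightedAtoms (J n N s) (Xpos n N s))
          (ωstar n N s) := by
      rcases hωstar with h | h
      · exact (h n N hn hN).mono fun _ => Or.inl
      · exact (h n N hn hN).mono fun _ => Or.inr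
    have hpt : ∀ᵐ s ∂P, BNPL.wmmd 𝓗 F₀ (BNPL.genLaw Gen FZ (ωstar n N s)) ≤
        (2 * √K + c) * ε + δ + 2 * M₁ * ∑ g ∈ G, x g s + 2 * M₂ * ∑ φ ∈ Φ, y φ s := by
      filter_upwards [hJ, hmin] with s hJs hmins
      have := BNPL.isProbabilityMeasure_weightedAtoms hJs.1 hJs.2 (Xpos n N s)
      have := BNPL.isProbabilityMeasure_empirical hN (Z n N s)
      have hxs : ∀ g : C(𝔛, ℝ), (∫ u, g u ∂(BNPL.weightedAtoms (J n N s) (Xpos n N s)) -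
          ∫ u, g u ∂F) ^ 2 = x g s := fun g => by
        rw [BNPL.integral_weightedAtoms hJs.1 _ g.continuous.measurable]
      have hxs' : ∀ g : C(𝔛, ℝ), (∫ u, g u ∂F -
          ∫ u, g u ∂(BNPL.weightedAtoms (J n N s) (Xpos n N s))) ^ 2 = x g s := fun g => by
        rw [sub_sq_comm, hxs]
      have h1 := hG F (BNPL.weightedAtoms (J n N s) (Xpos n N s))
      have h1' := hG (BNPL.weightedAtoms (J n N s) (Xpos n N s)) F
      simp_rw [hxs'] at h1
      simp_rw [hxs] at h1'
      have h2 := fun ω => hΦle (BNPL.empirical (Z n N s)) ω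
      have h3 := BNPL.wmmd_genLaw_le_of_isMinimizer hk hK hGen FZ F₀ F _ hT hN (Z n N s) h1 h1'
        (fun ω => (h2 ω).1) (fun ω => (h2 ω).2) hmins
      have h4 := BNPL.wmmd_huberMixture_le (𝓗 := 𝓗) hk hK hε0 hε1 F₀ Q
      rw [hc] at h4
      linarith
    have hix : Integrable (fun s => ∑ g ∈ G, x g s) P :=
      integrable_finsetSum _ fun g _ => (hxle g).1
    have hiy : Integrable (fun s => ∑ φ ∈ Φ, y φ s) P :=
      integrable_finsetSum _ fun φ hφ => (hyle φ hφ).1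
    have hIx : ∫ s, ∑ g ∈ G, x g s ∂P ≤ (∑ g ∈ G, r₁ g) * ρ := by
      rw [integral_finsetSum _ fun g _ => (hxle g).1, Finset.sum_mul]
      exact Finset.sum_le_sum fun g _ => (hxle g).2
    have hIy : ∫ s, ∑ φ ∈ Φ, y φ s ∂P ≤ (∑ φ ∈ Φ, r₂ φ) * ρ := by
      rw [integral_finsetSum _ fun φ hφ => (hyle φ hφ).1, Finset.sum_mul]
      exact Finset.sum_le_sum fun φ hφ => (hyle φ hφ).2
    have hi1 : Integrable (fun s => (2 * √K + c) * ε + δ + 2 * M₁ * ∑ g ∈ G, x g s) P :=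
      (integrable_const _).add (hix.const_mul _)
    calc ∫ s, BNPL.wmmd 𝓗 F₀ (BNPL.genLaw Gen FZ (ωstar n N s)) ∂P
        ≤ ∫ s, ((2 * √K + c) * ε + δ + 2 * M₁ * ∑ g ∈ G, x g s + 2 * M₂ * ∑ φ ∈ Φ, y φ s) ∂P :=
          integral_mono_ae (hint n N) (hi1.add (hiy.const_mul _)) hpt
      _ = (2 * √K + c) * ε + δ + 2 * M₁ * ∫ s, ∑ g ∈ G, x g s ∂P +
            2 * M₂ * ∫ s, ∑ φ ∈ Φ, y φ s ∂P := by
          rw [integral_add hi1 (hiy.const_mul _), integral_add (integrable_const _)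
            (hix.const_mul _), integral_const_mul, integral_const_mul]
          simp
      _ ≤ (2 * √K + c) * ε + δ + 2 * M₁ * ((∑ g ∈ G, r₁ g) * ρ) +
            2 * M₂ * ((∑ φ ∈ Φ, r₂ φ) * ρ) := by gcongr
      _ = _ := by ring
  have hlimsup := BNPL.limsup_coe_le_of_forall_exists_rate
    (e := fun q => ∫ s, BNPL.wmmd 𝓗 F₀ (BNPL.genLaw Gen FZ (ωstar q.1 q.2 s)) ∂P) hrate
  refine ⟨hint, hlimsup, fun hK1 => hlimsup.trans (EReal.coe_le_coe_iff.2 ?_)⟩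
  have h1 : √K ≤ 1 := Real.sqrt_le_one.2 hK1
  exact mul_le_mul_of_nonneg_right (by linarith) hε0
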